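/- Oracles are languages $X\subseteq\{0,1\}^*$; a language is also regarded as a subset of $\mathbb{N}$ by identifying the $(n+1)$-th string in length-lexicographic order with $n$. An oracle $X$ is \emph{low} if its Turing jump satisfies $X'\equiv_T\emptyset'$. An oracle $X$ is \emph{low for speed} if for every computable language $L\subseteq\{0,1\}^*$, every oracle Turing machine $M$ and every function $f:\{0,1\}^*\to\mathbb{N}$ such that $M$ with oracle $X$ decides $L$ and halts within $f(x)$ steps on every input $x$, there are a Turing machine $M'$ without oracle and a polynomial $p$ such that $M'$ decides $L$ and halts within $p(f(x))$ steps on every input $x$. Here machines are deterministic multi-tape machines; a query to the oracle about the string on the query tape takes one step. A set $G\subseteq\mathbb{N}$ is \emph{1-generic} if for every computably enumerable set $W$ of finite binary strings there is a prefix $\sigma$ of the characteristic sequence of $G$ such that $\sigma\in W$ or no extension of $\sigma$ (including $\sigma$ itself) is in $W$. For $G\subseteq\mathbb{N}$ let $S_G=\{0^{2^n} : n\in G\}$. \textbf{Theorem.} There exists a low, non-computable set $X\subseteq\{0,1\}^*$ which is low for speed. Moreover, $X$ can be taken of the form $X=S_G$ for some 1-generic set $G\subseteq\mathbb{N}$ that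 is $\Delta^0_2$ (that is, $G\le_T\emptyset'$). -/

import Mathlib

namespace LowForSpeed

/-! ### Oracle Turing machines -/

/-- Tape cells over a finite set `A` of auxiliary symbols: a cell is blank (`none`), holds a bit
`b` (`some (Sum.inl b)`), or holds an auxiliary symbol `a` (`some (Sum.inr a)`). -/
abbrev Cell (A : Type) : Type := Option (Bool ⊕ A)

instance instInhabitedCell (A : Type) : Inhabited (Cell A) := ⟨none⟩

/-- The instruction attached to a state of a machine with state set `Q`, auxiliary symbols `A`
and `k` tapes.
* `act δ`: depending on the `k` scanned symbols, go to a new state and, on every tape, write a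
  symbol and then move the head one cell to the left, one cell to the right, or not at all.
* `ask yes no`: ask the oracle about the word on the query tape; go to `yes` if it belongs to the
  oracle and to `no` otherwise.
* `halt b`: stop with output `b`. -/
inductive Instr (Q A : Type) (k : ℕ) : Type
  | act (δ : (Fin k → Cell A) → Q × (Fin k → Cell A × Option Turing.Dir)) : Instr Q A k
  | ask (yes no : Q) : Instr Q A k
  | halt (b : Bool) : Instr Q A k

/-- A deterministic multi-tape oracle Turing machine with `extraTapes + 2` two-way infinite tapes.
Tape `0` holds the input at the start, tape `1` is the query tape. -/
structure OracleTM where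
  State : Type
  Symb : Type
  [finiteState : Finite State]
  [finiteSymb : Finite Symb]
  extraTapes : ℕ
  start : State
  instr : State → Instr State Symb (extraTapes + 2)

/-- The longest block of bits at the beginning of a list of cells. -/
def leadingBits {A : Type} : List (Cell A) → List Bool
  | some (Sum.inl b) :: l => b :: leadingBits l
  | _ => []

theorem leadingBits_append_blank {A : Type} (l : List (Cell A)) (n : ℕ) :
    leadingBits (l ++ List.replicate n none) = leadingBits l := by
  induction l with
  | nil => cases n <;> simp [leadingBits, List.replicate_succ]
  | cons c l ih =>
    rcases c with _ | (b | a)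
    · simp [leadingBits]
    · simp [leadingBits, ih]
    · simp [leadingBits]

/-- The word on a query tape: the maximal block of bits that starts at the scanned cell and
extends to the right. It is the empty word if the scanned cell does not hold a bit. -/
def queryWord {A : Type} (T : Turing.Tape (Cell A)) : List Bool :=
  T.right₀.liftOn leadingBits (by
    rintro a b ⟨n, rfl⟩
    exact (leadingBits_append_blank a n).symm)

/-- Move the head of a tape, or leave it where it is. -/
def moveHead {A : Type} : Option Turing.Dir → Turing.Tape (Cell A) → Turing.Tape (Cell A)
  | none, T => T
  | some d, T => T.move d

namespace OracleTM

/-- A configuration: the current state and the tapes with their head positions. -/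
structure Cfg (M : OracleTM) where
  state : M.State
  tape : Fin (M.extraTapes + 2) → Turing.Tape (Cell M.Symb)

/-- The initial configuration: the input is written on tape `0`, with the head on its first bit;
all other cells are blank. -/
def init (M : OracleTM) (x : List Bool) : M.Cfg where
  state := M.start
  tape i := if i = 0 then Turing.Tape.mk₁ (x.map fun b => some (Sum.inl b)) else default

open Classical in
/-- One step of computation with oracle `X`. An oracle query takes one step; a configuration in a
halting state does not change any more. -/
noncomputable def step (M : OracleTM) (X : Language Bool) (c : M.Cfg) : M.Cfg :=
  match M.instr c.state with
  | .act δ =>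
    let r := δ fun i => (c.tape i).head
    { state := r.1
      tape := fun i => moveHead (r.2 i).2 ((c.tape i).write (r.2 i).1) }
  | .ask yes no =>
    { state := if queryWord (c.tape 1) ∈ X then yes else no
      tape := c.tape }
  | .halt _ => c

/-- With oracle `X`, on input `x`, the machine has halted with output `b` after at most `t`
steps. -/
def HaltsWithin (M : OracleTM) (X : Language Bool) (x : List Bool) (b : Bool) (t : ℕ) : Prop :=
  ∃ n ≤ t, M.instr ((M.step X)^[n] (M.init x)).state = .halt b

/-- With oracle `X`, the machine decides the language `L`, and its running time on each input `x`
is at most `f x`. -/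
def DecidesInTime (M : OracleTM) (X L : Language Bool) (f : List Bool → ℕ) : Prop :=
  ∀ x, ∃ b : Bool, M.HaltsWithin X x b (f x) ∧ (b = true ↔ x ∈ L)

/-- A machine without oracle: it has no query instruction. (Its computations do not depend on
the oracle, for which we then write the empty language,
which is `0` in Mathlib.) -/
def OracleFree (M : OracleTM) : Prop :=
  ∀ q yes no, M.instr q ≠ .ask yes no

end OracleTM

/-- A language is computable. -/
def IsComputable (L : Language Bool) : Prop :=
  ComputablePred fun w : List Bool => w ∈ L

/-- `X` is low for speed: every computable language that is decided in time `f` with oracle `X`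
is decided without oracle in time `p ∘ f` for some polynomial `p`. The time bound `f` may depend on
the input itself, not only on its length. -/
def IsLowForSpeed (X : Language Bool) : Prop :=
  ∀ L : Language Bool, IsComputable L →
    ∀ (M : OracleTM) (f : List Bool → ℕ), M.DecidesInTime X L f →
      ∃ (M' : OracleTM) (p : Polynomial ℕ),
        M'.OracleFree ∧ M'.DecidesInTime 0 L fun x => p.eval (f x)

/-! ### Turing functionals and the jump -/

/-- Codes for Turing functionals: the programs for functions that are partial recursive in an
oracle, one constructor for each closure condition of `Nat.RecursiveIn`. -/
inductive OracleCode : Type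
  | zero : OracleCode
  | succ : OracleCode
  | left : OracleCode
  | right : OracleCode
  | oracle : OracleCode
  | pair : OracleCode → OracleCode → OracleCode
  | comp : OracleCode → OracleCode → OracleCode
  | prec : OracleCode → OracleCode → OracleCode
  | rfind : OracleCode → OracleCode

namespace OracleCode

/-- The partial function computed by a code with oracle `g`. -/
def eval (g : ℕ →. ℕ) : OracleCode → ℕ →. ℕ
  | zero => fun _ => Part.some 0
  | succ => fun n => Part.some (n + 1)
  | left => fun n => Part.some n.unpair.1
  | right => fun n => Part.some n.unpair.2
  | oracle => g
  | pair cf cg => fun n => Nat.pair <$> eval g cf n <*> eval g cg n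
  | comp cf cg => fun n => eval g cg n >>= eval g cf
  | prec cf cg => fun p =>
      p.unpair.2.rec (eval g cf p.unpair.1) fun y IH => do
        let i ← IH
        eval g cg (Nat.pair p.unpair.1 (Nat.pair y i))
  | rfind cf => fun a => Nat.rfind fun n => (fun m => decide (m = 0)) <$> eval g cf (Nat.pair a n)

/-- The effective list of all codes: `n` is the number of the code `ofNat n`, and every code has
exactly one number. -/
def ofNat : ℕ → OracleCode
  | 0 => zero
  | 1 => succ
  | 2 => left
  | 3 => right
  | 4 => oracle
  | n + 5 =>
    have hm : n / 4 < n + 5 := by omega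
    have _h1 : (n / 4).unpair.1 < n + 5 := lt_of_le_of_lt (Nat.unpair_left_le _) hm
    have _h2 : (n / 4).unpair.2 < n + 5 := lt_of_le_of_lt (Nat.unpair_right_le _) hm
    match n % 4 with
    | 0 => pair (ofNat (n / 4).unpair.1) (ofNat (n / 4).unpair.2)
    | 1 => comp (ofNat (n / 4).unpair.1) (ofNat (n / 4).unpair.2)
    | 2 => prec (ofNat (n / 4).unpair.1) (ofNat (n / 4).unpair.2)
    | _ => rfind (ofNat (n / 4))

end OracleCode

open Classical in
/-- The characteristic function of a set of natural numbers. -/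
noncomputable def charFn (A : Set ℕ) : ℕ →. ℕ :=
  fun n => Part.some (if n ∈ A then 1 else 0)

/-- The Turing jump: the set of all `e` such that the `e`-th Turing functional with oracle `A`
converges on input `e`. -/
def jump (A : Set ℕ) : Set ℕ :=
  {e | ((OracleCode.ofNat e).eval (charFn A) e).Dom}

/-- The identification of binary strings with natural numbers: the position, counted from `0`, of
a string in the length-lexicographic order. -/
def strIndex (w : List Bool) : ℕ :=
  w.foldl (fun n b => 2 * n + b.toNat) 1 - 1

/-- A language as a set of natural numbers. -/
def natSet (X : Language Bool) : Set ℕ :=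
  {n | ∃ w ∈ X, strIndex w = n}

/-- `X` is low: its jump is Turing equivalent to the jump of the empty set. -/
def IsLow (X : Language Bool) : Prop :=
  TuringEquivalent (charFn (jump (natSet X))) (charFn (jump ∅))

/-! ### Generic sets and the sparse language of a set -/

/-- The finite string `σ` is a prefix of the characteristic sequence of `G`. -/
def IsPrefixOf (σ : List Bool) (G : Set ℕ) : Prop :=
  ∀ (i : ℕ) (hi : i < σ.length), σ[i] = true ↔ i ∈ G

/-- `G` is 1-generic: for every computably enumerable set `W` of finite strings, some prefix of `G`
belongs to `W` or has no extension in `W`. -/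
def IsOneGeneric (G : Set ℕ) : Prop :=
  ∀ W : Set (List Bool), REPred (fun σ : List Bool => σ ∈ W) →
    ∃ σ : List Bool, IsPrefixOf σ G ∧ (σ ∈ W ∨ ∀ τ : List Bool, σ <+: τ → τ ∉ W)

/-- The language of all words `0 ^ (2 ^ n)` with `n ∈ G`. -/
def sparseLang (G : Set ℕ) : Language Bool :=
  {w | ∃ n ∈ G, w = List.replicate (2 ^ n) false}

end LowForSpeed

namespace LowForSpeed

/-! ### Coded Turing functionals: compilation, the use principle, and c.e. sets below the jump. -/

namespace OracleCode

open Nat.Partrec (Code)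

/-! The set G is built by finite extension. Stage s asks the halting problem whether the current
string has an extension in the s-th c.e. set of strings, moves to one if so, and appends a bit so
that lengths grow (`genericSeq_succ`). Hence G is 1-generic and computable from ∅'. For lowness, the
strings that make the e-th functional converge at e form a c.e. set whose index is computable from
e. The corresponding stage decides whether e lies in the jump of `sparseLang G`
(`isLow_sparseLang_genericSet`). A computable G would not be 1-generic, because every string has an
extension that disagrees with it.

Lowness for speed holds for every 1-generic G. Let M decide a computable L in time f with oracle
`sparseLang G`. The strings that already determine a computation of M with a wrong output form a
c.e. set, since L is computable, and no prefix of G belongs to it. By genericity some prefix σ of G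
has no extension in it, so M is never wrong with any oracle given by a string extending σ
(`IsOneGeneric.exists_forcing`). Thus M can be run with all oracles σ ++ ρ in turn, and the first
output is correct even if ρ does not agree with G.

Sparseness makes this search polynomial. Queries made within f x steps have length O(f x), so only
about log (f x) bits of G matter, and there are only O(f x) strings ρ to try. Put T = 2 ^ (|σ| +
|ρ|). The round of ρ simulates up to T steps of M, each at cost O(T), and at most 2T rounds precede
or include the good one. The total is O(T ^ 3), with T linear in f x.

The value f x is unknown to the search and may be smaller than the length of the input, so the input
can be neither copied nor reread between rounds. Instead each round records the overwritten symbols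
in a log and is undone by running the log backwards (`reaches_back`). The log also serves as the
clock. The ruler tape holds the current oracle, one cell for each word length, and doubles together
with the log when ρ gets longer. -/

theorem mem_eval_pair {g : ℕ →. ℕ} {a b : OracleCode} {n v : ℕ} :
    v ∈ (pair a b).eval g n ↔ ∃ x ∈ a.eval g n, ∃ y ∈ b.eval g n, Nat.pair x y = v := by
  simp [eval, Seq.seq]

theorem mem_eval_comp {g : ℕ →. ℕ} {a b : OracleCode} {n v : ℕ} :
    v ∈ (comp a b).eval g n ↔ ∃ x ∈ b.eval g n, v ∈ a.eval g x :=
  Part.mem_bind_iff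

theorem eval_primRec (g : ℕ →. ℕ) (a b : OracleCode) (n : ℕ) :
    (prec a b).eval g n = Nat.rec (a.eval g n.unpair.1) (fun y IH => IH.bind fun i =>
      b.eval g (Nat.pair n.unpair.1 (Nat.pair y i))) n.unpair.2 := rfl

theorem mem_eval_rfind {g : ℕ →. ℕ} {a : OracleCode} {n v : ℕ} :
    v ∈ (rfind a).eval g n ↔ 0 ∈ a.eval g (Nat.pair n v) ∧
      ∀ m < v, ∃ y ∈ a.eval g (Nat.pair n m), y ≠ 0 := by
  refine Nat.mem_rfind.trans ?_
  simp [Part.mem_map_iff]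

/-! ### Compiling oracle programs to programs without oracle -/

/-- Replace the oracle by the program `oc`. -/
def toCode (oc : Code) : OracleCode → Code
  | zero => .zero
  | succ => .succ
  | left => .left
  | right => .right
  | oracle => oc
  | pair a b => .pair (toCode oc a) (toCode oc b)
  | comp a b => .comp (toCode oc a) (toCode oc b)
  | prec a b => .prec (toCode oc a) (toCode oc b)
  | rfind a => .comp (.rfind' (toCode oc a)) (.pair .id .zero)

theorem eval_toCode (oc : Code) (c : OracleCode) : (toCode oc c).eval = c.eval oc.eval := by
  induction c with
  | zero => funext n; simp [toCode, eval, Code.eval]; rfl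
  | succ | left | right => funext n; simp [toCode, eval, Code.eval]
  | oracle => rfl
  | pair a b iha ihb => funext n; simp [toCode, eval, Code.eval, iha, ihb]
  | comp a b iha ihb => funext n; simp [toCode, eval, Code.eval, iha, ihb]
  | prec a b iha ihb => funext n; simp [toCode, eval, Code.eval, iha, ihb, Nat.unpaired]
  | rfind a iha =>
    funext n
    -- `rfind'` starts its search at the second component of the input, so the input is paired with
    -- 0.
    have hz : (Code.pair .id .zero).eval n = Part.some (Nat.pair n 0) := by
      simp [Code.eval, Code.eval_id, Seq.seq, show (pure 0 : ℕ →. ℕ) n = Part.some 0 from rfl]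
    change ((Code.pair .id .zero).eval n).bind (fun m => (Code.rfind' (toCode oc a)).eval m) = _
    rw [hz, Part.bind_some, Code.eval, Nat.unpaired, Nat.unpair_pair, iha]
    simp [eval, Part.map_id']

/-- One step of the course-of-values recursion that computes `toCode oc (ofNat n)`. -/
def toCodeAux (oc : Code) (L : List Code) : Option Code :=
  if L.length < 5 then [Code.zero, .succ, .left, .right, oc][L.length]? else
  (L[((L.length - 5) / 4).unpair.1]?).bind fun a =>
  (L[((L.length - 5) / 4).unpair.2]?).bind fun b =>
  (L[(L.length - 5) / 4]?).map fun c =>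
  -- Remainder 3 is out of range of the list, so the default value is the `rfind` case.
  [Code.pair a b, .comp a b, .prec a b].getD ((L.length - 5) % 4)
    (.comp (.rfind' c) (.pair .id .zero))

theorem primrec_toCodeAux : Primrec₂ toCodeAux := by
  have hlen : Primrec fun p : Code × List Code => p.2.length :=
    Primrec.list_length.comp Primrec.snd
  have hm : Primrec fun p : Code × List Code => (p.2.length - 5) / 4 :=
    Primrec.nat_div.comp (Primrec.nat_sub.comp hlen (Primrec.const 5)) (Primrec.const 4)
  have hr : Primrec fun p : Code × List Code => (p.2.length - 5) % 4 :=
    Primrec.nat_mod.comp (Primrec.nat_sub.comp hlen (Primrec.const 5)) (Primrec.const 4)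
  refine Primrec.ite (Primrec.nat_lt.comp hlen (Primrec.const 5)) ?_ ?_
  · exact Primrec.list_getElem?.comp
      (Primrec.list_cons.comp (Primrec.const _) (Primrec.list_cons.comp (Primrec.const _)
        (Primrec.list_cons.comp (Primrec.const _) (Primrec.list_cons.comp (Primrec.const _)
          (Primrec.list_cons.comp Primrec.fst (Primrec.const _)))))) hlen
  · refine Primrec.option_bind
      (Primrec.list_getElem?.comp Primrec.snd (Primrec.fst.comp (Primrec.unpair.comp hm))) ?_
    refine Primrec.option_bind
      (Primrec.list_getElem?.comp (Primrec.snd.comp Primrec.fst)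
        (Primrec.snd.comp (Primrec.unpair.comp (hm.comp Primrec.fst)))) ?_
    refine Primrec.option_map
      (Primrec.list_getElem?.comp (Primrec.snd.comp (Primrec.fst.comp Primrec.fst))
        (hm.comp (Primrec.fst.comp Primrec.fst))) ?_
    have ha : Primrec fun p : (((Code × List Code) × Code) × Code) × Code => p.1.1.2 :=
      Primrec.snd.comp (Primrec.fst.comp Primrec.fst)
    have hb : Primrec fun p : (((Code × List Code) × Code) × Code) × Code => p.1.2 :=
      Primrec.snd.comp Primrec.fst
    refine Primrec.option_getD.comp (Primrec.list_getElem?.comp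
      (Primrec.list_cons.comp (Code.primrec₂_pair.comp ha hb)
        (Primrec.list_cons.comp (Code.primrec₂_comp.comp ha hb)
          (Primrec.list_cons.comp (Code.primrec₂_prec.comp ha hb) (Primrec.const [])))) 
        (hr.comp (Primrec.fst.comp (Primrec.fst.comp Primrec.fst))))
      (Code.primrec₂_comp.comp (Code.primrec_rfind'.comp Primrec.snd)
        (Primrec.const (Code.pair .id .zero))) |>.of_eq ?_
    rintro ⟨p, c⟩; simp only [List.getD_eq_getElem?_getD]

theorem ofNat_pair_num (a b : ℕ) : ofNat (4 * Nat.pair a b + 5) = pair (ofNat a) (ofNat b) := by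
  rw [ofNat]
  simp

theorem ofNat_comp_num (a b : ℕ) :
    ofNat (4 * Nat.pair a b + 1 + 5) = comp (ofNat a) (ofNat b) := by
  rw [ofNat]
  have h1 : (4 * Nat.pair a b + 1) / 4 = Nat.pair a b := by omega
  have h2 : (4 * Nat.pair a b + 1) % 4 = 1 := by omega
  simp [h1, h2]

theorem ofNat_prec_num (a b : ℕ) :
    ofNat (4 * Nat.pair a b + 2 + 5) = prec (ofNat a) (ofNat b) := by
  rw [ofNat]
  have h1 : (4 * Nat.pair a b + 2) / 4 = Nat.pair a b := by omega
  have h2 : (4 * Nat.pair a b + 2) % 4 = 2 := by omega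
  simp [h1, h2]

theorem ofNat_rfind_num (a : ℕ) : ofNat (4 * a + 3 + 5) = rfind (ofNat a) := by
  rw [ofNat]
  have h1 : (4 * a + 3) / 4 = a := by omega
  have h2 : (4 * a + 3) % 4 = 3 := by omega
  simp [h1, h2]

theorem ofNat_surjective : Function.Surjective ofNat := by
  intro c
  induction c with
  | zero => exact ⟨0, by rw [ofNat]⟩
  | succ => exact ⟨1, by rw [ofNat]⟩
  | left => exact ⟨2, by rw [ofNat]⟩
  | right => exact ⟨3, by rw [ofNat]⟩
  | oracle => exact ⟨4, by rw [ofNat]⟩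
  | pair a b iha ihb =>
    obtain ⟨⟨m, rfl⟩, ⟨n, rfl⟩⟩ := And.intro iha ihb
    exact ⟨_, ofNat_pair_num m n⟩
  | comp a b iha ihb =>
    obtain ⟨⟨m, rfl⟩, ⟨n, rfl⟩⟩ := And.intro iha ihb
    exact ⟨_, ofNat_comp_num m n⟩
  | prec a b iha ihb =>
    obtain ⟨⟨m, rfl⟩, ⟨n, rfl⟩⟩ := And.intro iha ihb
    exact ⟨_, ofNat_prec_num m n⟩
  | rfind a iha =>
    obtain ⟨m, rfl⟩ := iha
    exact ⟨_, ofNat_rfind_num m⟩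

theorem toCodeAux_spec (oc : Code) (n : ℕ) :
    toCodeAux oc ((List.range n).map fun k => toCode oc (ofNat k)) =
      some (toCode oc (ofNat n)) := by
  by_cases hn : n < 5
  · interval_cases n <;> simp [toCodeAux, toCode, ofNat]
  · obtain ⟨n, rfl⟩ : ∃ k, n = k + 5 := ⟨n - 5, by omega⟩
    have hm : n / 4 < n + 5 := by omega
    have h1 : (n / 4).unpair.1 < n + 5 := lt_of_le_of_lt (Nat.unpair_left_le _) hm
    have h2 : (n / 4).unpair.2 < n + 5 := lt_of_le_of_lt (Nat.unpair_right_le _) hm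
    have hr : n % 4 = 0 ∨ n % 4 = 1 ∨ n % 4 = 2 ∨ n % 4 = 3 := by omega
    rw [ofNat]
    rcases hr with hr | hr | hr | hr <;>
      simp [toCodeAux, hm, h1, h2, hr, toCode]

theorem primrec_toCode_ofNat : Primrec₂ fun (oc : Code) (n : ℕ) => toCode oc (ofNat n) :=
  Primrec.nat_strong_rec _ primrec_toCodeAux toCodeAux_spec

/-! ### Monotonicity and finite use -/

/-- A convergent computation uses only oracle values that are defined. For `rfind` this needs that
all earlier tests converge, so no new smaller zero can appear. -/
theorem eval_mono {g h : ℕ →. ℕ} (hgh : ∀ n v, v ∈ g n → v ∈ h n) (c : OracleCode) :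
    ∀ n v, v ∈ c.eval g n → v ∈ c.eval h n := by
  induction c with
  | zero | succ | left | right => exact fun n v hv => hv
  | oracle => exact hgh
  | pair a b iha ihb =>
    intro n v
    simp only [mem_eval_pair]
    rintro ⟨x, hx, y, hy, rfl⟩
    exact ⟨x, iha _ _ hx, y, ihb _ _ hy, rfl⟩
  | comp a b iha ihb =>
    intro n v
    simp only [mem_eval_comp]
    rintro ⟨x, hx, hv⟩
    exact ⟨x, ihb _ _ hx, iha _ _ hv⟩
  | prec a b iha ihb =>
    intro n v
    simp only [eval_primRec]
    generalize n.unpair.2 = k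
    induction k generalizing v with
    | zero => exact iha _ _
    | succ k ih =>
      simp only [Part.mem_bind_iff]
      rintro ⟨x, hx, hv⟩
      exact ⟨x, ih _ hx, ihb _ _ hv⟩
  | rfind a iha =>
    intro n v
    simp only [mem_eval_rfind]
    rintro ⟨h0, hlt⟩
    refine ⟨iha _ _ h0, fun m hm => ?_⟩
    obtain ⟨y, hy, h1⟩ := hlt m hm
    exact ⟨y, iha _ _ hy, h1⟩

/-- The restriction of a partial function to the numbers below `s`. -/
def restrict (g : ℕ →. ℕ) (s : ℕ) : ℕ →. ℕ := fun n => Part.assert (n < s) fun _ => g n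

theorem mem_restrict {g : ℕ →. ℕ} {s n v : ℕ} : v ∈ restrict g s n ↔ n < s ∧ v ∈ g n := by
  simp [restrict, Part.mem_assert_iff]

theorem restrict_mono {g : ℕ →. ℕ} {s t : ℕ} (hst : s ≤ t) (c : OracleCode) {n v : ℕ}
    (hv : v ∈ c.eval (restrict g s) n) : v ∈ c.eval (restrict g t) n :=
  eval_mono (fun _ _ h => mem_restrict.2
    ⟨(mem_restrict.1 h).1.trans_le hst, (mem_restrict.1 h).2⟩) c n v hv

/-- The use principle: a convergent computation asks finitely many questions, and by monotonicity
the bounds of its parts can be replaced by their maximum. -/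
theorem exists_restrict {g : ℕ →. ℕ} (c : OracleCode) :
    ∀ n v, v ∈ c.eval g n → ∃ s, v ∈ c.eval (restrict g s) n := by
  induction c with
  | zero | succ | left | right => exact fun n v hv => ⟨0, hv⟩
  | oracle => exact fun n v hv => ⟨n + 1, mem_restrict.2 ⟨n.lt_succ_self, hv⟩⟩
  | pair a b iha ihb =>
    intro n v
    simp only [mem_eval_pair]
    rintro ⟨x, hx, y, hy, rfl⟩
    obtain ⟨s, hs⟩ := iha _ _ hx
    obtain ⟨t, ht⟩ := ihb _ _ hy
    exact ⟨max s t, x, restrict_mono (le_max_left _ _) _ hs, y,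
      restrict_mono (le_max_right _ _) _ ht, rfl⟩
  | comp a b iha ihb =>
    intro n v
    simp only [mem_eval_comp]
    rintro ⟨x, hx, hv⟩
    obtain ⟨s, hs⟩ := ihb _ _ hx
    obtain ⟨t, ht⟩ := iha _ _ hv
    exact ⟨max s t, x, restrict_mono (le_max_left _ _) _ hs, restrict_mono (le_max_right _ _) _ ht⟩
  | prec a b iha ihb =>
    intro n v hv
    -- Writing the input as a pair frees the recursion counter for induction.
    suffices h : ∀ k v, v ∈ (prec a b).eval g (Nat.pair n.unpair.1 k) →
        ∃ s, v ∈ (prec a b).eval (restrict g s) (Nat.pair n.unpair.1 k) by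
      simpa using h n.unpair.2 v (by simpa using hv)
    clear hv v
    intro k
    induction k with
    | zero => simpa [eval_primRec] using iha n.unpair.1
    | succ k ih =>
      intro v hv
      have key : ∀ g', v ∈ (prec a b).eval g' (Nat.pair n.unpair.1 (k + 1)) ↔
          ∃ x ∈ (prec a b).eval g' (Nat.pair n.unpair.1 k),
            v ∈ b.eval g' (Nat.pair n.unpair.1 (Nat.pair k x)) := by
        intro g'
        simp [eval_primRec]
      obtain ⟨x, hx, hv⟩ := (key g).1 hv
      obtain ⟨s, hs⟩ := ih _ hx
      obtain ⟨t, ht⟩ := ihb _ _ hv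
      exact ⟨max s t, (key _).2 ⟨x, restrict_mono (le_max_left _ _) _ hs,
        restrict_mono (le_max_right _ _) _ ht⟩⟩
  | rfind a iha =>
    intro n v
    simp only [mem_eval_rfind]
    rintro ⟨h0, hlt⟩
    obtain ⟨s, hs⟩ := iha _ _ h0
    -- One bound for all failed tests below v, collected one test at a time.
    have hlt' : ∀ k ≤ v, ∃ t, ∀ m < k, ∃ y ∈ a.eval (restrict g t) (Nat.pair n m), y ≠ 0 := by
      intro k
      induction k with
      | zero => exact fun _ => ⟨0, fun m hm => absurd hm (Nat.not_lt_zero m)⟩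
      | succ k ihk =>
        intro hk
        obtain ⟨t, ht⟩ := ihk (Nat.le_of_succ_le hk)
        obtain ⟨y, hy, h1⟩ := hlt k hk
        obtain ⟨u, hu⟩ := iha _ _ hy
        refine ⟨max t u, fun m hm => ?_⟩
        rcases Nat.lt_succ_iff_lt_or_eq.1 hm with hm | rfl
        · obtain ⟨z, hz, h2⟩ := ht m hm
          exact ⟨z, restrict_mono (le_max_left _ _) _ hz, h2⟩
        · exact ⟨y, restrict_mono (le_max_right _ _) _ hu, h1⟩
    obtain ⟨t, ht⟩ := hlt' v le_rfl
    refine ⟨max s t, restrict_mono (le_max_left _ _) _ hs, fun m hm => ?_⟩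
    obtain ⟨y, hy, h1⟩ := ht m hm
    exact ⟨y, restrict_mono (le_max_right _ _) _ hy, h1⟩

/-! ### Completeness of the jump -/

theorem exists_code {f : ℕ →. ℕ} (hf : Nat.Partrec f) : ∃ c : OracleCode, ∀ g, c.eval g = f := by
  induction hf with
  | zero => exact ⟨zero, fun g => rfl⟩
  | succ => exact ⟨succ, fun g => rfl⟩
  | left => exact ⟨left, fun g => rfl⟩
  | right => exact ⟨right, fun g => rfl⟩
  | pair _ _ iha ihb =>
    obtain ⟨⟨a, ha⟩, ⟨b, hb⟩⟩ := And.intro iha ihb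
    exact ⟨pair a b, fun g => by rw [eval, ha, hb]⟩
  | comp _ _ iha ihb =>
    obtain ⟨⟨a, ha⟩, ⟨b, hb⟩⟩ := And.intro iha ihb
    exact ⟨comp a b, fun g => by rw [eval, ha, hb]⟩
  | prec _ _ iha ihb =>
    obtain ⟨⟨a, ha⟩, ⟨b, hb⟩⟩ := And.intro iha ihb
    exact ⟨prec a b, fun g => by rw [eval, ha, hb]⟩
  | rfind _ iha =>
    obtain ⟨a, ha⟩ := iha
    exact ⟨rfind a, fun g => by rw [eval, ha]⟩

/-- The number of a program for the constant function with value `n`. -/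
def constNum (n : ℕ) : ℕ := Nat.rec 0 (fun _ k => 4 * Nat.pair 1 k + 1 + 5) n

theorem eval_constNum (g : ℕ →. ℕ) (n m : ℕ) : (ofNat (constNum n)).eval g m = Part.some n := by
  induction n with
  | zero => simp [constNum, ofNat, eval]
  | succ n ih =>
    have h : constNum (n + 1) = 4 * Nat.pair 1 (constNum n) + 1 + 5 := rfl
    rw [h, ofNat_comp_num]
    refine Part.eq_some_iff.2 (mem_eval_comp.2 ⟨n, ih ▸ Part.mem_some n, ?_⟩)
    simp [ofNat, eval]

theorem primrec_constNum : Primrec constNum :=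
  Primrec.nat_rec₁ 0 (Primrec.nat_add.comp (Primrec.nat_add.comp (Primrec.nat_mul.comp
    (Primrec.const 4) (Primrec₂.natPair.comp (Primrec.const 1) Primrec.snd)) (Primrec.const 1))
    (Primrec.const 5))

end OracleCode

open OracleCode

/-- `h n` numbers the program that ignores its input and runs the semi-decision of p on n.
Self-application in the jump is then harmless, and since the program never consults its oracle, one
h serves every A. -/
theorem exists_reduction_jump {p : ℕ → Prop} (hp : REPred p) :
    ∃ h : ℕ → ℕ, Computable h ∧ ∀ A n, p n ↔ h n ∈ jump A := by
  obtain ⟨c, hc⟩ := exists_code (Partrec.nat_iff.1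
    (hp.map (β := Unit) (σ := ℕ) (g := fun _ _ => 0) (Computable.const 0).to₂))
  obtain ⟨k, rfl⟩ := ofNat_surjective c
  refine ⟨fun n => 4 * Nat.pair k (constNum n) + 1 + 5, ?_, fun A n => ?_⟩
  · exact (Primrec.nat_add.comp (Primrec.nat_add.comp (Primrec.nat_mul.comp
      (Primrec.const 4) (Primrec₂.natPair.comp (Primrec.const k) primrec_constNum))
      (Primrec.const 1)) (Primrec.const 5)).to_comp
  · change _ ↔ ((ofNat (4 * Nat.pair k (constNum n) + 1 + 5)).eval (charFn A) _).Dom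
    rw [ofNat_comp_num, Part.dom_iff_mem]
    simp only [mem_eval_comp, eval_constNum, Part.mem_some_iff, exists_eq_left, hc]
    rw [← Part.dom_iff_mem]
    simp [Part.assert]

theorem charFn_turingReducible_jump {p : ℕ → Prop} (hp : REPred p) (A : Set ℕ) :
    TuringReducible (charFn {n | p n}) (charFn (jump A)) := by
  obtain ⟨h, hc, hh⟩ := exists_reduction_jump hp
  rw [TuringReducible, RecursiveIn.iff_nat]
  have h1 : Nat.RecursiveIn {charFn (jump A)} (fun n => Part.some (h n)) :=
    Nat.Partrec.recursiveIn (Partrec.nat_iff.1 hc.partrec)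
  refine ((Nat.RecursiveIn.oracle (charFn (jump A)) (Set.mem_singleton _)).comp h1).of_eq fun n => ?_
  refine (Part.bind_some _ _).trans ?_
  by_cases hn : p n
  · simp [charFn, hn, (hh A n).1 hn]
  · simp [charFn, hn, mt (hh A n).2 hn]

theorem charFn_empty : charFn ∅ = Nat.Partrec.Code.zero.eval := by
  funext n; simp [charFn, Nat.Partrec.Code.eval]; rfl

/-- The characteristic function of ∅ is itself computed by a program, which can be compiled in place
of the oracle. -/
theorem rePred_jump_empty : REPred fun n => n ∈ jump ∅ := by
  have h : Partrec fun n => (toCode .zero (ofNat n)).eval n :=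
    Nat.Partrec.Code.eval_part.comp
      (primrec_toCode_ofNat.to_comp.comp (Computable.const _) Computable.id) Computable.id
  refine h.dom_re.of_eq fun n => ?_
  rw [eval_toCode, jump, charFn_empty]; rfl

end LowForSpeed

/-! ### The 1-generic set below ∅', its lowness and its noncomputability. -/

namespace LowForSpeed

open Nat.Partrec (Code)
open Encodable (encode decode)
open OracleCode (restrict mem_restrict)

/-! ### Functions computable from the halting problem -/

-- The jump decides p, and then only the selected branch is run, so the other one may diverge.
open Classical in
theorem recursiveIn_ite {p : ℕ → Prop} (hp : REPred p) {F H : ℕ →. ℕ} (hF : Partrec F)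
    (hH : Partrec H) (A : Set ℕ) :
    Nat.RecursiveIn {charFn (jump A)} (fun n => if p n then F n else H n) := by
  have h1 : Nat.RecursiveIn {charFn (jump A)} (charFn {n | p n}) :=
    RecursiveIn.iff_nat.1 (charFn_turingReducible_jump hp A)
  have h2 : Partrec fun m : ℕ => cond (m.unpair.2 == 1) (F m.unpair.1) (H m.unpair.1) :=
    Partrec.cond
      (Primrec.beq.comp (Primrec.snd.comp Primrec.unpair) (Primrec.const 1)).to_comp
      (hF.comp (Computable.fst.comp Computable.unpair))
      (hH.comp (Computable.fst.comp Computable.unpair))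
  have hid : Nat.RecursiveIn {charFn (jump A)} (fun n => Part.some n) :=
    Nat.Partrec.recursiveIn Nat.Partrec.some
  refine ((Nat.Partrec.recursiveIn (Partrec.nat_iff.1 h2)).comp (hid.pair h1)).of_eq fun n => ?_
  have h3 : (Nat.pair <$> Part.some n <*> charFn {n | p n} n) =
      Part.some (Nat.pair n (if p n then 1 else 0)) := by
    by_cases hn : p n <;> simp [charFn, Seq.seq, hn]
  rw [h3]
  refine (Part.bind_some _ _).trans ?_
  by_cases hn : p n <;> simp [hn]

/-! ### Construction of a generic set -/

theorem rePred_exists {α : Type*} [Primcodable α] {p : α → ℕ → Prop} {f : α × ℕ → Bool}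
    (hf : Computable f) (hp : ∀ q, f q = true ↔ p q.1 q.2) : REPred fun a => ∃ n, p a n := by
  have h : Partrec fun a => Nat.rfind fun n => Part.some (f (a, n)) :=
    Partrec.rfind (Computable.partrec hf)
  refine h.dom_re.of_eq fun a => ?_
  refine Nat.rfind_dom'.trans ?_
  simp only [Part.mem_some_iff, Part.some_dom, implies_true, and_true, eq_comm (a := true)]
  exact exists_congr fun n => hp (a, n)

/-- The `s`-th computably enumerable set of strings. -/
def ceSet (s : ℕ) : Set (List Bool) :=
  {τ | ((Denumerable.ofNat Code s).eval (encode τ)).Dom}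

/-- The s-m-n theorem. Computability of v matters for lowness: it tells which stage of the
construction decides e. -/
theorem exists_ceSet {W : ℕ → List Bool → Prop} (hW : REPred fun p : ℕ × List Bool => W p.1 p.2) :
    ∃ v : ℕ → ℕ, Computable v ∧ ∀ e τ, τ ∈ ceSet (v e) ↔ W e τ := by
  obtain ⟨d, hd⟩ := Code.exists_code.1 hW
  refine ⟨fun e => encode (d.curry e), ?_, fun e τ => ?_⟩
  · exact Computable.encode.comp
      (Code.primrec₂_curry.to_comp.comp (Computable.const d) Computable.id)
  · simp [ceSet, Code.eval_curry, hd, Part.assert]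

/-- Search for an extension of a string in the `s`-th computably enumerable set. -/
def searchExt (p : ℕ × List Bool) : Part (List Bool) :=
  Nat.rfindOpt fun n => (decode (α := ℕ × List Bool) n).bind fun q =>
    (Code.evaln q.1 (Denumerable.ofNat Code p.1) (encode (p.2 ++ q.2))).map fun _ => p.2 ++ q.2

theorem partrec_searchExt : Partrec searchExt := by
  refine Partrec.rfindOpt (Primrec.to_comp ?_)
  refine Primrec.option_bind (Primrec.decode.comp Primrec.snd) ?_
  have h : Primrec fun a : ((ℕ × List Bool) × ℕ) × (ℕ × List Bool) => a.1.1.2 ++ a.2.2 :=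
    Primrec.list_append.comp (Primrec.snd.comp (Primrec.fst.comp Primrec.fst))
      (Primrec.snd.comp Primrec.snd)
  refine Primrec.option_map (Code.primrec_evaln.comp (((Primrec.fst.comp Primrec.snd).pair
    ((Primrec.ofNat Code).comp (Primrec.fst.comp (Primrec.fst.comp Primrec.fst)))).pair
      (Primrec.encode.comp h))) ?_
  exact h.comp Primrec.fst

theorem searchExt_spec {s : ℕ} {σ τ : List Bool} (h : τ ∈ searchExt (s, σ)) :
    σ <+: τ ∧ τ ∈ ceSet s := by
  obtain ⟨n, hn⟩ := Nat.rfindOpt_spec h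
  simp only [Option.mem_def, Option.bind_eq_some_iff, Option.map_eq_some_iff] at hn
  obtain ⟨q, -, v, hv, rfl⟩ := hn
  exact ⟨List.prefix_append _ _, Part.dom_iff_mem.2 ⟨v, Code.evaln_sound hv⟩⟩

theorem searchExt_dom {s : ℕ} {σ τ : List Bool} (h : σ <+: τ) (hτ : τ ∈ ceSet s) :
    (searchExt (s, σ)).Dom := by
  obtain ⟨ρ, rfl⟩ := h
  obtain ⟨v, hv⟩ := Part.dom_iff_mem.1 hτ
  obtain ⟨k, hk⟩ := Code.evaln_complete.1 hv
  refine Nat.rfindOpt_dom.2 ⟨encode (k, ρ), σ ++ ρ, ?_⟩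
  rw [Encodable.encodek, Option.bind_some, Option.mem_def.1 hk]
  rfl

open Classical in
/-- Extend a string into the `s`-th computably enumerable set if possible, and add a bit. -/
noncomputable def genericStep (s : ℕ) (σ : List Bool) : List Bool :=
  (if h : (searchExt (s, σ)).Dom then (searchExt (s, σ)).get h else σ) ++ [false]

/-- The finite strings that build a generic set. -/
noncomputable def genericSeq : ℕ → List Bool
  | 0 => []
  | s + 1 => genericStep s (genericSeq s)

/-- Stage s forces the s-th c.e. set: it is either met or avoided by all later extensions. The bit
appended in both cases makes the strings exhaust a characteristic sequence. -/
theorem genericSeq_succ (s : ℕ) :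
    (∃ τ ∈ ceSet s, genericSeq s <+: τ ∧ genericSeq (s + 1) = τ ++ [false]) ∨
      (∀ τ, genericSeq s <+: τ → τ ∉ ceSet s) ∧ genericSeq (s + 1) = genericSeq s ++ [false] := by
  rw [genericSeq, genericStep]
  split_ifs with h
  · obtain ⟨h1, h2⟩ := searchExt_spec (Part.get_mem h)
    exact Or.inl ⟨_, h2, h1, rfl⟩
  · exact Or.inr ⟨fun τ hτ hW => h (searchExt_dom hτ hW), rfl⟩

theorem genericSeq_prefix_succ (s : ℕ) : genericSeq s <+: genericSeq (s + 1) := by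
  rcases genericSeq_succ s with ⟨τ, -, h, he⟩ | ⟨-, he⟩
  · exact he ▸ h.trans (List.prefix_append _ _)
  · exact he ▸ List.prefix_append _ _

theorem genericSeq_prefix {s t : ℕ} (h : s ≤ t) : genericSeq s <+: genericSeq t := by
  induction h with
  | refl => exact List.prefix_rfl
  | step _ ih => exact ih.trans (genericSeq_prefix_succ _)

theorem le_length_genericSeq (s : ℕ) : s ≤ (genericSeq s).length := by
  induction s with
  | zero => exact Nat.zero_le _
  | succ s ih =>
    rcases genericSeq_succ s with ⟨τ, -, h, he⟩ | ⟨-, he⟩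
    · have := h.length_le
      simp [he]; omega
    · simp [he, ih]

/-- The set of positions of a string that hold the bit `true`. -/
def bitSet (σ : List Bool) : Set ℕ := {n | σ[n]? = some true}

/-- The set whose characteristic sequence has the prefixes `genericSeq s`. -/
def genericSet : Set ℕ := {n | n ∈ bitSet (genericSeq (n + 1))}

theorem isPrefixOf_iff {σ : List Bool} {G : Set ℕ} :
    IsPrefixOf σ G ↔ ∀ n < σ.length, n ∈ bitSet σ ↔ n ∈ G := by
  refine forall₂_congr fun n hn => ?_
  change _ ↔ (σ[n]? = some true ↔ _)
  rw [List.getElem?_eq_getElem hn, Option.some_inj]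

theorem IsPrefixOf.of_prefix {σ τ : List Bool} {G : Set ℕ} (h : σ <+: τ) (hτ : IsPrefixOf τ G) :
    IsPrefixOf σ G := fun i hi => by
  rw [h.getElem hi]
  exact hτ i (hi.trans_le h.length_le)

theorem mem_bitSet_of_prefix {σ τ : List Bool} (h : σ <+: τ) {n : ℕ} (hn : n < σ.length) :
    n ∈ bitSet σ ↔ n ∈ bitSet τ := by
  change σ[n]? = some true ↔ τ[n]? = some true
  rw [List.getElem?_eq_getElem hn, List.getElem?_eq_getElem (hn.trans_le h.length_le),
    h.getElem hn]

theorem isPrefixOf_genericSet (s : ℕ) : IsPrefixOf (genericSeq s) genericSet := by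
  rw [isPrefixOf_iff]
  intro n hn
  have h1 := le_length_genericSeq (n + 1)
  change _ ↔ n ∈ bitSet (genericSeq (n + 1))
  rcases le_total s (n + 1) with h | h
  · exact mem_bitSet_of_prefix (genericSeq_prefix h) hn
  · exact (mem_bitSet_of_prefix (genericSeq_prefix h) h1).symm

theorem isOneGeneric_genericSet : IsOneGeneric genericSet := by
  intro W hW
  -- A single set is a constant family, so the index `v 0` serves.
  obtain ⟨v, -, hv⟩ := exists_ceSet (W := fun _ τ => τ ∈ W) (hW.comp Computable.snd)
  rcases genericSeq_succ (v 0) with ⟨τ, h1, -, h2⟩ | ⟨h, -⟩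
  · exact ⟨τ, (isPrefixOf_genericSet (v 0 + 1)).of_prefix (h2 ▸ List.prefix_append _ _),
      Or.inl ((hv _ _).1 h1)⟩
  · exact ⟨_, isPrefixOf_genericSet (v 0), Or.inr fun τ hτ h' => h τ hτ ((hv _ _).2 h')⟩

theorem recursiveIn_genericSeq :
    Nat.RecursiveIn {charFn (jump ∅)} (fun s => Part.some (encode (genericSeq s))) := by
  classical
  -- `prec` passes to its step function the parameter 0, the stage and the previous value, nested as
  -- pairs. The previous value is the code of a string.
  let dec : ℕ → List Bool := fun n => (decode (α := List Bool) n.unpair.2.unpair.2).getD []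
  have hdec : Primrec dec := Primrec.option_getD.comp (Primrec.decode.comp (Primrec.snd.comp
    (Primrec.unpair.comp (Primrec.snd.comp Primrec.unpair)))) (Primrec.const [])
  let arg : ℕ → ℕ × List Bool := fun n => (n.unpair.2.unpair.1, dec n)
  have harg : Computable arg := ((Primrec.fst.comp (Primrec.unpair.comp (Primrec.snd.comp
    Primrec.unpair))).pair hdec).to_comp
  have happ : Computable fun σ : List Bool => encode (σ ++ [false]) :=
    (Primrec.encode.comp (Primrec.list_append.comp Primrec.id (Primrec.const [false]))).to_comp
  have hp : REPred fun n => (searchExt (arg n)).Dom := (partrec_searchExt.comp harg).dom_re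
  have h := recursiveIn_ite hp (F := fun n => (searchExt (arg n)).map fun σ => encode (σ ++ [false]))
    (H := fun n => Part.some (encode (dec n ++ [false])))
    ((partrec_searchExt.comp harg).map (happ.comp Computable.snd).to₂)
    (happ.comp hdec.to_comp) ∅
  have h0 : Nat.RecursiveIn {charFn (jump ∅)} (fun _ => Part.some (encode ([] : List Bool))) :=
    Nat.Partrec.recursiveIn (Partrec.nat_iff.1 (Computable.const _).partrec)
  have hpair : Nat.RecursiveIn {charFn (jump ∅)} (fun n => Part.some (Nat.pair 0 n)) :=
    Nat.Partrec.recursiveIn (Partrec.nat_iff.1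
      (Primrec₂.natPair.comp (Primrec.const 0) Primrec.id).to_comp.partrec)
  refine ((h0.prec h).comp hpair).of_eq fun n => ?_
  refine (Part.bind_some _ _).trans ?_
  simp only [Nat.unpair_pair]
  induction n with
  | zero => rfl
  | succ n ih =>
    refine (congrArg (fun x => Part.bind x _) ih).trans ?_
    rw [Part.bind_some]
    have h1 : arg (Nat.pair 0 (Nat.pair n (encode (genericSeq n)))) = (n, genericSeq n) := by
      simp [arg, dec]
    have h2 : dec (Nat.pair 0 (Nat.pair n (encode (genericSeq n)))) = genericSeq n := by
      simp [dec]
    rw [h1, h2, genericSeq, genericStep]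
    split_ifs with hd
    · obtain ⟨τ, hτ⟩ := Part.dom_iff_mem.1 hd
      rw [Part.get_eq_of_mem hτ, Part.eq_some_iff.2 hτ, Part.map_some]
    · rfl

/-- From ∅' one computes the string of stage `v e` and then decides a c.e. property of it. Both G ≤
∅' and the lowness of `sparseLang G` have this form. -/
theorem recursiveIn_rePred_genericSeq {V : ℕ × List Bool → Prop} (hV : REPred V) {v : ℕ → ℕ}
    (hv : Computable v) :
    Nat.RecursiveIn {charFn (jump ∅)} (charFn {e | V (e, genericSeq (v e))}) := by
  classical
  have hdec : Computable fun m : ℕ => (m.unpair.1, (decode (α := List Bool) m.unpair.2).getD []) :=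
    ((Primrec.fst.comp Primrec.unpair).pair (Primrec.option_getD.comp (Primrec.decode.comp
      (Primrec.snd.comp Primrec.unpair)) (Primrec.const []))).to_comp
  have h1 : Nat.RecursiveIn {charFn (jump ∅)} (charFn {m : ℕ |
      V (m.unpair.1, (decode (α := List Bool) m.unpair.2).getD [])}) :=
    RecursiveIn.iff_nat.1 (charFn_turingReducible_jump (hV.comp hdec) ∅)
  have hid : Nat.RecursiveIn {charFn (jump ∅)} (fun n => Part.some n) :=
    Nat.Partrec.recursiveIn Nat.Partrec.some
  have hv' : Nat.RecursiveIn {charFn (jump ∅)} (fun n => Part.some (v n)) :=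
    Nat.Partrec.recursiveIn (Partrec.nat_iff.1 hv.partrec)
  refine (h1.comp (hid.pair (recursiveIn_genericSeq.comp hv'))).of_eq fun e => ?_
  have h2 : (Nat.pair <$> Part.some e <*> (Part.some (v e)).bind fun s =>
      Part.some (encode (genericSeq s))) = Part.some (Nat.pair e (encode (genericSeq (v e)))) := by
    simp [Seq.seq]
  refine (congrArg (fun x => Part.bind x _) h2).trans ((Part.bind_some _ _).trans ?_)
  simp [charFn]

theorem genericSet_le_jump : TuringReducible (charFn genericSet) (charFn (jump ∅)) := by
  refine RecursiveIn.iff_nat.2 ?_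
  refine recursiveIn_rePred_genericSeq (V := fun p => p.2[p.1]? = some true) ?_ Computable.succ
  exact ((Primrec.eq (α := Option Bool)).comp (Primrec.list_getElem?.comp Primrec.snd Primrec.fst)
    (Primrec.const (some true))).computablePred.to_re

/-! ### Lowness -/

theorem strIndex_replicate_false (j : ℕ) : strIndex (List.replicate j false) = 2 ^ j - 1 := by
  have h : ∀ a, List.foldl (fun n b => 2 * n + b.toNat) a (List.replicate j false) = a * 2 ^ j := by
    induction j with
    | zero => simp
    | succ j ih => intro a; simp [List.replicate_succ, ih, pow_succ]; ring
  rw [strIndex, h, one_mul]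

/-- The string 0 ^ j has index 2 ^ j - 1. The bound n < k + 1 is automatic; it makes the quantifier
bounded and shows that only bits of G up to k are relevant to k. -/
theorem mem_natSet_sparseLang {G : Set ℕ} {k : ℕ} :
    k ∈ natSet (sparseLang G) ↔ ∃ n < k + 1, k + 1 = 2 ^ 2 ^ n ∧ n ∈ G := by
  have hpos : ∀ n : ℕ, n < 2 ^ 2 ^ n := fun n =>
    (Nat.lt_two_pow_self).trans (Nat.lt_two_pow_self)
  constructor
  · rintro ⟨_, ⟨n, hn, rfl⟩, h⟩
    rw [strIndex_replicate_false] at h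
    have := hpos n
    exact ⟨n, by omega, by omega, hn⟩
  · rintro ⟨n, -, h, hn⟩
    exact ⟨_, ⟨n, hn, rfl⟩, by rw [strIndex_replicate_false]; omega⟩

/-- The part of the sparse oracle that is determined by a string. -/
noncomputable def stringOracle (σ : List Bool) : ℕ →. ℕ :=
  restrict (charFn (natSet (sparseLang (bitSet σ)))) σ.length

theorem stringOracle_eq {σ : List Bool} {G : Set ℕ} (h : IsPrefixOf σ G) :
    stringOracle σ = restrict (charFn (natSet (sparseLang G))) σ.length := by
  rw [isPrefixOf_iff] at h
  funext k
  refine Part.ext fun v => ?_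
  rw [stringOracle, mem_restrict, mem_restrict]
  refine and_congr_right fun hk => ?_
  have : k ∈ natSet (sparseLang (bitSet σ)) ↔ k ∈ natSet (sparseLang G) := by
    rw [mem_natSet_sparseLang, mem_natSet_sparseLang]
    refine exists_congr fun n => and_congr_right fun hn => and_congr_right fun _ => h n (by omega)
  by_cases h : k ∈ natSet (sparseLang G)
  · simp [charFn, h, this.2 h]
  · simp [charFn, h, mt this.1 h]

theorem primrec_nat_pow : Primrec₂ ((· ^ ·) : ℕ → ℕ → ℕ) :=
  Primrec₂.unpaired'.1 Nat.Primrec.pow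

theorem primrec_replicate_two_pow : Primrec fun n : ℕ => List.replicate (2 ^ n) false :=
  (Primrec.list_map (Primrec.list_range.comp (primrec_nat_pow.comp (Primrec.const 2) Primrec.id))
    (Primrec.const false).to₂).of_eq fun n => by simp

theorem partrec_stringOracle : Partrec₂ stringOracle := by
  classical
  have h1 : PrimrecRel fun (n : ℕ) (p : List Bool × ℕ) =>
      p.2 + 1 = 2 ^ 2 ^ n ∧ p.1[n]? = some true := by
    refine PrimrecPred.and (Primrec.eq.comp (Primrec.succ.comp (Primrec.snd.comp Primrec.snd))
      (primrec_nat_pow.comp (Primrec.const 2) (primrec_nat_pow.comp (Primrec.const 2)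
        Primrec.fst))) ?_
    exact Primrec.eq.comp (Primrec.list_getElem?.comp (Primrec.fst.comp Primrec.snd) Primrec.fst)
      (Primrec.const (some true))
  have h2 : PrimrecPred fun p : List Bool × ℕ => p.2 ∈ natSet (sparseLang (bitSet p.1)) := by
    refine (PrimrecRel.comp h1.exists_mem_list (Primrec.list_range.comp
      (Primrec.succ.comp Primrec.snd)) Primrec.id).of_eq fun p => ?_
    rw [mem_natSet_sparseLang]
    simp [bitSet]
  have h3 : Primrec fun p : List Bool × ℕ =>
      if p.2 ∈ natSet (sparseLang (bitSet p.1)) then 1 else 0 :=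
    Primrec.ite h2 (Primrec.const 1) (Primrec.const 0)
  have h4 : PrimrecPred fun p : List Bool × ℕ => p.2 < p.1.length :=
    Primrec.nat_lt.comp Primrec.snd (Primrec.list_length.comp Primrec.fst)
  refine (Partrec.cond h4.decide.to_comp h3.to_comp.partrec Partrec.none).of_eq fun p => ?_
  refine Part.ext fun v => ?_
  rw [stringOracle, mem_restrict]
  by_cases h : p.2 < p.1.length <;> simp [h, charFn]

theorem rePred_eval_stringOracle : REPred fun p : ℕ × List Bool =>
    ((OracleCode.ofNat p.1).eval (stringOracle p.2) p.1).Dom := by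
  have h1 : Partrec fun m : ℕ =>
      stringOracle ((decode (α := List Bool) m.unpair.1).getD []) m.unpair.2 :=
    partrec_stringOracle.comp (Primrec.option_getD.comp (Primrec.decode.comp (Primrec.fst.comp
      Primrec.unpair)) (Primrec.const [])).to_comp (Computable.snd.comp Computable.unpair)
  obtain ⟨d, hd⟩ := Code.exists_code.1 (Partrec.nat_iff.1 h1)
  have h2 : Partrec fun p : ℕ × List Bool =>
      (OracleCode.toCode (d.curry (encode p.2)) (OracleCode.ofNat p.1)).eval p.1 :=
    Code.eval_part.comp (OracleCode.primrec_toCode_ofNat.to_comp.comp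
      (Code.primrec₂_curry.to_comp.comp (Computable.const d)
        (Computable.encode.comp Computable.snd)) Computable.fst) Computable.fst
  refine h2.dom_re.of_eq fun p => ?_
  have h3 : (d.curry (encode p.2)).eval = stringOracle p.2 := by
    funext k
    rw [Code.eval_curry, hd]
    simp
  rw [OracleCode.eval_toCode, h3]

/-- The claim is that e is in the jump iff the string of stage `v e + 1` alone makes the e-th
functional converge at e; this is a c.e. condition on a string computable from ∅'. The other
reduction only uses that ∅' is c.e. -/
theorem isLow_sparseLang_genericSet : IsLow (sparseLang genericSet) := by
  refine ⟨?_, charFn_turingReducible_jump rePred_jump_empty _⟩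
  obtain ⟨v, hv, hvW⟩ := exists_ceSet
    (W := fun e σ => ((OracleCode.ofNat e).eval (stringOracle σ) e).Dom) rePred_eval_stringOracle
  have h := recursiveIn_rePred_genericSeq rePred_eval_stringOracle (Computable.succ.comp hv)
  refine RecursiveIn.iff_nat.2 ?_
  convert h using 2
  ext e
  change ((OracleCode.ofNat e).eval (charFn (natSet (sparseLang genericSet))) e).Dom ↔
    ((OracleCode.ofNat e).eval (stringOracle (genericSeq (v e + 1))) e).Dom
  simp only [Part.dom_iff_mem]
  constructor
  -- A convergent computation has finite use, so some later string of the construction lies in the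
  -- c.e. set. Hence stage `v e` found an extension there.
  · rintro ⟨x, hx⟩
    obtain ⟨s, hs⟩ := OracleCode.exists_restrict _ _ _ hx
    have hmem : genericSeq (max s (v e)) ∈ ceSet (v e) := by
      refine (hvW _ _).2 (Part.dom_iff_mem.2 ⟨x, ?_⟩)
      rw [stringOracle_eq (isPrefixOf_genericSet _)]
      exact OracleCode.restrict_mono ((le_max_left _ _).trans (le_length_genericSeq _)) _ hs
    rcases genericSeq_succ (v e) with ⟨τ, hτ, -, he⟩ | ⟨hn, -⟩
    · have hpre : τ <+: genericSeq (v e + 1) := he ▸ List.prefix_append _ _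
      obtain ⟨y, hy⟩ := Part.dom_iff_mem.1 ((hvW _ _).1 hτ)
      rw [stringOracle_eq ((isPrefixOf_genericSet _).of_prefix hpre)] at hy
      refine ⟨y, ?_⟩
      rw [stringOracle_eq (isPrefixOf_genericSet _)]
      exact OracleCode.restrict_mono hpre.length_le _ hy
    · exact absurd hmem (hn _ (genericSeq_prefix (le_max_right _ _)))
  · rintro ⟨x, hx⟩
    rw [stringOracle_eq (isPrefixOf_genericSet _)] at hx
    exact ⟨x, OracleCode.eval_mono (fun n v h => (mem_restrict.1 h).2) _ _ _ hx⟩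

/-! ### Generic sets are not computable -/

/-- If G were computable, the strings that disagree with G would be c.e. No prefix of G is among
them, yet appending one wrong bit puts an extension of any prefix there. -/
theorem IsOneGeneric.not_computablePred {G : Set ℕ} (hG : IsOneGeneric G) :
    ¬ ComputablePred fun n => n ∈ G := by
  classical
  intro hc
  obtain ⟨σ, hσ, h⟩ := hG {σ | ∃ n, n < σ.length ∧ ¬ (n ∈ bitSet σ ↔ n ∈ G)} (by
    refine rePred_exists (f := fun q : List Bool × ℕ =>
      decide (q.2 < q.1.length) && (decide (q.1[q.2]? = some true) != decide (q.2 ∈ G))) ?_ ?_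
    · refine Primrec.and.to_comp.comp (Primrec.nat_lt.comp Primrec.snd
        (Primrec.list_length.comp Primrec.fst)).decide.to_comp ?_
      exact (Primrec.dom_bool₂ (fun a b => a != b)).to_comp.comp ((Primrec.eq.comp
        (Primrec.list_getElem?.comp Primrec.fst Primrec.snd)
          (Primrec.const (some true))).decide.to_comp) (hc.decide.comp Computable.snd)
    · intro q
      by_cases h1 : q.1[q.2]? = some true <;> by_cases h2 : q.2 ∈ G <;> simp [bitSet, h1, h2])
  rw [isPrefixOf_iff] at hσ
  rcases h with ⟨n, hn, h⟩ | h
  · exact h (hσ n hn)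
  · refine h (σ ++ [! decide (σ.length ∈ G)]) (List.prefix_append _ _) ⟨σ.length, by simp, ?_⟩
    by_cases hm : σ.length ∈ G <;> simp [bitSet, hm]

theorem not_isComputable_sparseLang {G : Set ℕ} (hG : IsOneGeneric G) :
    ¬ IsComputable (sparseLang G) := by
  intro h
  refine hG.not_computablePred ?_
  classical
  refine (Computable.computablePred (p := fun n => List.replicate (2 ^ n) false ∈ sparseLang G)
    (h.decide.comp primrec_replicate_two_pow.to_comp)).of_eq fun n => ?_
  constructor
  · rintro ⟨m, hm, he⟩
    have := congrArg List.length he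
    simp only [List.length_replicate] at this
    rwa [Nat.pow_right_injective le_rfl this]
  · exact fun hn => ⟨n, hn, rfl⟩

end LowForSpeed

/-! ### Bounded use of oracle machines, their computable simulation, and forcing correct outputs. -/

namespace LowForSpeed

open Turing (Tape ListBlank)
open Encodable (encode decode)

/-! ### Tapes given by pairs of lists -/

section ListTape

variable {Γ : Type} [Inhabited Γ]

/-- The tape with the list `p.1` to the left of the head (the nearest cell first) and the list
`p.2` from the head to the right. -/
def listTape (p : List Γ × List Γ) : Tape Γ := Tape.mk' (ListBlank.mk p.1) (ListBlank.mk p.2)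

theorem exists_listTape (T : Tape Γ) : ∃ p, T = listTape p := by
  obtain ⟨L, R, rfl⟩ := T.exists_mk'
  induction L using ListBlank.induction_on
  induction R using ListBlank.induction_on
  exact ⟨(_, _), rfl⟩

theorem listTape_head (p : List Γ × List Γ) : (listTape p).head = p.2.headI := rfl

theorem listTape_write (p : List Γ × List Γ) (a : Γ) :
    (listTape p).write a = listTape (p.1, a :: p.2.tail) := rfl

theorem listTape_move_right (p : List Γ × List Γ) :
    (listTape p).move .right = listTape (p.2.headI :: p.1, p.2.tail) := by
  rw [listTape, Tape.move_right_mk', ListBlank.head_mk, ListBlank.tail_mk, ListBlank.cons_mk]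
  rfl

theorem listTape_move_left (p : List Γ × List Γ) :
    (listTape p).move .left = listTape (p.1.tail, p.1.headI :: p.2) := by
  rw [listTape, Tape.move_left_mk', ListBlank.head_mk, ListBlank.tail_mk, ListBlank.cons_mk]
  rfl

end ListTape

theorem queryWord_listTape {A : Type} (p : List (Cell A) × List (Cell A)) :
    queryWord (listTape p) = leadingBits p.2 := by
  rw [queryWord, listTape, Tape.mk'_right₀]; rfl

theorem leadingBits_length_le {A : Type} (l : List (Cell A)) :
    (leadingBits l).length ≤ l.length := by
  induction l with
  | nil => simp [leadingBits]
  | cons c l ih => rcases c with _ | (b | a) <;> simp [leadingBits, ih]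

theorem primrec_leadingBits {A : Type} [Primcodable A] :
    Primrec (leadingBits : List (Cell A) → List Bool) := by
  have h1 : Primrec₂ fun (_ : List (Cell A)) (q : Cell A × List Bool) =>
      (Option.casesOn q.1 [] fun s => Sum.casesOn s (fun b => b :: q.2) fun _ => [] : List Bool) := by
    refine Primrec.option_casesOn (Primrec.fst.comp Primrec.snd) (Primrec.const []) ?_
    refine Primrec.sumCasesOn Primrec.snd ?_ (Primrec.const []).to₂
    exact Primrec.list_cons.comp Primrec.snd
      (Primrec.snd.comp (Primrec.snd.comp (Primrec.fst.comp Primrec.fst)))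
  refine (Primrec.list_foldr Primrec.id (Primrec.const []) h1).of_eq fun l => ?_
  induction l with
  | nil => rfl
  | cons c l ih => rcases c with _ | (b | a) <;> simp_all [leadingBits]

/-! ### The running machine depends on short queries only -/

namespace OracleTM

theorem step_congr (M : OracleTM) {X Y : Language Bool} {c : M.Cfg}
    (h : queryWord (c.tape 1) ∈ X ↔ queryWord (c.tape 1) ∈ Y) : M.step X c = M.step Y c := by
  classical
  unfold step
  split <;> simp only [h]

theorem step_of_act (M : OracleTM) {X : Language Bool} {c : M.Cfg} {δ r}
    (h : M.instr c.state = .act δ) (hr : (δ fun i => (c.tape i).head) = r) :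
    M.step X c =
      ⟨r.1, fun i => moveHead (r.2 i).2 ((c.tape i).write (r.2 i).1)⟩ := by
  subst hr
  unfold step; split <;> simp_all

open Classical in
theorem step_of_ask (M : OracleTM) {X : Language Bool} {c : M.Cfg} {yes no : M.State}
    (h : M.instr c.state = .ask yes no) :
    M.step X c = ⟨if queryWord (c.tape 1) ∈ X then yes else no, c.tape⟩ := by
  unfold step; split <;> simp_all

theorem step_of_halt (M : OracleTM) {X : Language Bool} {c : M.Cfg} {b : Bool}
    (h : M.instr c.state = .halt b) : M.step X c = c := by
  unfold step; split <;> simp_all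

theorem iterate_step_of_halt (M : OracleTM) {X : Language Bool} {c : M.Cfg} {b : Bool}
    (h : M.instr c.state = .halt b) (n : ℕ) : (M.step X)^[n] c = c :=
  Function.iterate_fixed (M.step_of_halt h) n

/-- The query tape starts blank, and a step adds at most two cells to its description: one by
writing on a blank and one by moving left past the end. -/
theorem exists_queryTape_bound (M : OracleTM) (X : Language Bool) (x : List Bool) (n : ℕ) :
    ∃ p, ((M.step X)^[n] (M.init x)).tape 1 = listTape p ∧ p.1.length + p.2.length ≤ 2 * n := by
  classical
  induction n with
  | zero => exact ⟨([], []), rfl, le_rfl⟩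
  | succ n ih =>
    obtain ⟨p, hp, hn⟩ := ih
    rw [Function.iterate_succ_apply']
    set c := (M.step X)^[n] (M.init x)
    unfold step
    split
    · rename_i δ _
      simp only [hp]
      generalize (δ fun i => (c.tape i).head).2 1 = r
      rw [listTape_write]
      have ht : (p.2.tail).length ≤ p.2.length := by simp
      have ht' : (p.1.tail).length ≤ p.1.length := by simp
      have h2 : p.2.tail.length + 1 ≤ p.2.length + 1 := by omega
      rcases r with ⟨a, _ | _ | _⟩
      · exact ⟨_, rfl, by simp; omega⟩
      · refine ⟨_, listTape_move_left _, ?_⟩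
        by_cases h0 : p.1 = []
        · simp [h0]; omega
        · have := List.length_pos_iff.2 h0
          simp; omega
      · exact ⟨_, listTape_move_right _, by simp; omega⟩
    · exact ⟨p, hp, by omega⟩
    · exact ⟨p, hp, by omega⟩

theorem queryWord_length_le (M : OracleTM) (X : Language Bool) (x : List Bool) (n : ℕ) :
    (queryWord (((M.step X)^[n] (M.init x)).tape 1)).length ≤ 2 * n := by
  obtain ⟨p, hp, hn⟩ := M.exists_queryTape_bound X x n
  rw [hp, queryWord_listTape]
  have := leadingBits_length_le p.2
  omega

/-- The queries among the first n steps are made after at most n - 1 steps, so their words have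
length below 2 * n. -/
theorem iterate_step_congr (M : OracleTM) {X Y : Language Bool} (x : List Bool) {n : ℕ}
    (h : ∀ w : List Bool, w.length < 2 * n → (w ∈ X ↔ w ∈ Y)) :
    (M.step X)^[n] (M.init x) = (M.step Y)^[n] (M.init x) := by
  induction n with
  | zero => rfl
  | succ n ih =>
    rw [Function.iterate_succ_apply', Function.iterate_succ_apply',
      ← ih fun w hw => h w (by omega)]
    refine M.step_congr (h _ ?_)
    have := M.queryWord_length_le X x n
    omega

end OracleTM

theorem mem_sparseLang_congr {σ : List Bool} {G : Set ℕ} (h : IsPrefixOf σ G) {w : List Bool}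
    (hw : w.length < 2 ^ σ.length) : w ∈ sparseLang (bitSet σ) ↔ w ∈ sparseLang G := by
  rw [isPrefixOf_iff] at h
  refine exists_congr fun n => and_congr_left ?_
  rintro rfl
  refine h n ?_
  rw [List.length_replicate] at hw
  exact (Nat.pow_lt_pow_iff_right (by norm_num)).1 hw

/-! ### Machines can be simulated computably -/

theorem primrec_pi {n : ℕ} {α β : Type*} [Primcodable α] [Primcodable β] {f : α → Fin n → β}
    (h : ∀ i, Primrec fun a => f a i) : Primrec f :=
  Primrec.fin_curry.2 (Primrec₂.swap (Primrec.fin_curry₁.2 h))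

theorem primrecRel_mem_sparseLang :
    PrimrecRel fun (σ w : List Bool) => w ∈ sparseLang (bitSet σ) := by
  have h1 : PrimrecRel fun (n : ℕ) (p : List Bool × List Bool) =>
      p.1[n]? = some true ∧ p.2 = List.replicate (2 ^ n) false :=
    (Primrec.eq.comp (Primrec.list_getElem?.comp (Primrec.fst.comp Primrec.snd) Primrec.fst)
      (Primrec.const (some true))).and
      (Primrec.eq.comp (Primrec.snd.comp Primrec.snd)
        (primrec_replicate_two_pow.comp Primrec.fst))
  refine (PrimrecRel.comp h1.exists_mem_list (Primrec.list_range.comp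
      (Primrec.list_length.comp Primrec.fst)) Primrec.id).of_eq fun p => ?_
  constructor
  · rintro ⟨n, -, h⟩
    exact ⟨n, h⟩
  · rintro ⟨n, h1, h2⟩
    refine ⟨n, List.mem_range.2 ?_, h1, h2⟩
    by_contra h
    exact absurd (show p.1[n]? = some true from h1) (by simp [List.getElem?_eq_none (not_lt.1 h)])

namespace OracleTM

variable (M : OracleTM)

/-- Configurations whose tapes are given by pairs of lists. -/
abbrev ListCfg : Type :=
  M.State × (Fin (M.extraTapes + 2) → List (Cell M.Symb) × List (Cell M.Symb))

/-- The configuration described by lists. -/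
def ofListCfg (c : M.ListCfg) : M.Cfg := ⟨c.1, fun i => listTape (c.2 i)⟩

/-- The initial configuration, given by lists. -/
def listInit (x : List Bool) : M.ListCfg :=
  (M.start, fun i => ([], if i = 0 then x.map fun b => some (Sum.inl b) else []))

theorem ofListCfg_listInit (x : List Bool) : M.ofListCfg (M.listInit x) = M.init x := by
  unfold ofListCfg listInit init
  congr 1
  funext i
  by_cases h : i = 0 <;> simp only [h, if_true, if_false] <;> rfl

/-- The state and the scanned symbols. -/
def listScan (c : M.ListCfg) : M.State × (Fin (M.extraTapes + 2) → Cell M.Symb) :=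
  (c.1, fun i => (c.2 i).2.headI)

/-- The effect of an `act` instruction; other instructions leave the tapes unchanged. -/
def actResult (s : M.State × (Fin (M.extraTapes + 2) → Cell M.Symb)) :
    M.State × (Fin (M.extraTapes + 2) → Cell M.Symb × Option Turing.Dir) :=
  match M.instr s.1 with
  | .act δ => δ s.2
  | _ => (s.1, fun i => (s.2 i, none))

/-- The possible successor states of a query. -/
def askTargets (q : M.State) : Option (M.State × M.State) :=
  match M.instr q with
  | .ask yes no => some (yes, no)
  | _ => none

/-- The output in a halting state. -/
def haltOutput (q : M.State) : Option Bool :=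
  match M.instr q with
  | .halt b => some b
  | _ => none

theorem haltOutput_eq_some {q : M.State} {b : Bool} :
    M.haltOutput q = some b ↔ M.instr q = .halt b := by
  unfold haltOutput
  cases M.instr q <;> simp

/-- Write a symbol and move on a tape given by lists; the direction is given by two flags. -/
def listAct {Γ : Type} [Inhabited Γ] (a : Γ) (l r : Bool) (p : List Γ × List Γ) :
    List Γ × List Γ :=
  cond l (p.1.tail, p.1.headI :: a :: p.2.tail) (cond r (a :: p.1, p.2.tail) (p.1, a :: p.2.tail))

open Classical in
/-- One step with a finite oracle on configurations given by lists. -/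
noncomputable def listStep (σ : List Bool) (c : M.ListCfg) : M.ListCfg :=
  match M.askTargets c.1 with
  | some t => (if leadingBits (c.2 1).2 ∈ sparseLang (bitSet σ) then t.1 else t.2, c.2)
  | none => ((M.actResult (M.listScan c)).1, fun i =>
      listAct ((M.actResult (M.listScan c)).2 i).1
        (decide (((M.actResult (M.listScan c)).2 i).2 = some .left))
        (decide (((M.actResult (M.listScan c)).2 i).2 = some .right)) (c.2 i))

theorem step_ofListCfg (σ : List Bool) (c : M.ListCfg) :
    M.step (sparseLang (bitSet σ)) (M.ofListCfg c) = M.ofListCfg (M.listStep σ c) := by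
  have hhead : ∀ p : List (Cell M.Symb) × List (Cell M.Symb),
      listTape (p.1, p.2.headI :: p.2.tail) = listTape p := by
    intro p
    conv_rhs => rw [← Tape.write_self (listTape p), listTape_write]
    rfl
  unfold step listStep
  simp only [ofListCfg]
  split
  · rename_i δ h
    have h1 : M.askTargets c.1 = none := by simp [askTargets, h]
    have h2 : M.actResult (M.listScan c) = δ (M.listScan c).2 := by
      simp [actResult, listScan, h]
    simp only [h1, h2]
    congr 1
    funext i
    change moveHead ((δ (M.listScan c).2).2 i).2
      ((listTape (c.2 i)).write ((δ (M.listScan c).2).2 i).1) = _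
    generalize (δ (M.listScan c).2).2 i = r
    rcases r with ⟨a, _ | _ | _⟩
    · rfl
    · simp [moveHead, listTape_write, listTape_move_left, listAct]
    · simp [moveHead, listTape_write, listTape_move_right, listAct]
  · rename_i yes no h
    have h1 : M.askTargets c.1 = some (yes, no) := by simp [askTargets, h]
    simp only [h1]
    have hw := queryWord_listTape (c.2 1)
    refine congrArg (fun s => Cfg.mk s fun i => listTape (c.2 i)) ?_
    by_cases hm : leadingBits (c.2 1).2 ∈ sparseLang (bitSet σ)
    · exact (if_pos (hw ▸ hm)).trans (if_pos hm).symm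
    · exact (if_neg (hw ▸ hm)).trans (if_neg hm).symm
  · rename_i b h
    have h1 : M.askTargets c.1 = none := by simp [askTargets, h]
    have h2 : M.actResult (M.listScan c) = (c.1, fun i => ((c.2 i).2.headI, none)) := by
      simp [actResult, listScan, h]
    simp only [h1, h2]
    simp [listAct, hhead]

theorem iterate_step_eq (σ x : List Bool) (n : ℕ) :
    (M.step (sparseLang (bitSet σ)))^[n] (M.init x) =
      M.ofListCfg ((M.listStep σ)^[n] (M.listInit x)) := by
  induction n with
  | zero => exact (M.ofListCfg_listInit x).symm
  | succ n ih => rw [Function.iterate_succ_apply', Function.iterate_succ_apply', ih, step_ofListCfg]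

section Primrec

variable [Primcodable M.State] [Primcodable M.Symb]

theorem primrec_listAct {α Γ : Type} [Primcodable α] [Primcodable Γ] [Inhabited Γ] {a : α → Γ}
    {l r : α → Bool} {p : α → List Γ × List Γ} (ha : Primrec a) (hl : Primrec l) (hr : Primrec r)
    (hp : Primrec p) : Primrec fun x => listAct (a x) (l x) (r x) (p x) := by
  have h1 := Primrec.fst.comp hp
  have h2 := Primrec.list_tail.comp (Primrec.snd.comp hp)
  refine Primrec.cond hl ?_ (Primrec.cond hr ?_ ?_)
  · exact (Primrec.list_tail.comp h1).pair (Primrec.list_cons.comp (Primrec.list_headI.comp h1)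
      (Primrec.list_cons.comp ha h2))
  · exact (Primrec.list_cons.comp ha h1).pair h2
  · exact h1.pair (Primrec.list_cons.comp ha h2)

theorem primrec_listStep : Primrec₂ M.listStep := by
  have := M.finiteState
  have := M.finiteSymb
  have hc : Primrec fun p : List Bool × M.ListCfg => p.2 := Primrec.snd
  have ht : ∀ i, Primrec fun p : List Bool × M.ListCfg => p.2.2 i := fun i =>
    Primrec.fin_app.comp (Primrec.snd.comp hc) (Primrec.const i)
  have hs : Primrec fun p : List Bool × M.ListCfg => M.listScan p.2 :=
    (Primrec.fst.comp hc).pair (primrec_pi fun i => Primrec.list_headI.comp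
      (Primrec.snd.comp (ht i)))
  -- The program table of M is a function on a finite type, hence primitive recursive.
  have hact : ∀ {β : Type} [Primcodable β]
      (f : M.State × (Fin (M.extraTapes + 2) → Cell M.Symb) → β),
      Primrec fun p : List Bool × M.ListCfg => f (M.listScan p.2) :=
    fun f => (Primrec.dom_finite f).comp hs
  have hq : PrimrecPred fun p : List Bool × M.ListCfg =>
      leadingBits (p.2.2 1).2 ∈ sparseLang (bitSet p.1) :=
    primrecRel_mem_sparseLang.comp Primrec.fst
      (primrec_leadingBits.comp (Primrec.snd.comp (ht 1)))
  refine (Primrec.option_casesOn (o := fun p : List Bool × M.ListCfg => M.askTargets p.2.1)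
    (f := fun p => ((M.actResult (M.listScan p.2)).1, fun i =>
      listAct ((M.actResult (M.listScan p.2)).2 i).1
        (decide (((M.actResult (M.listScan p.2)).2 i).2 = some .left))
        (decide (((M.actResult (M.listScan p.2)).2 i).2 = some .right)) (p.2.2 i)))
    (g := fun p t => (open Classical in
      if leadingBits (p.2.2 1).2 ∈ sparseLang (bitSet p.1) then t.1 else t.2, p.2.2))
    ((Primrec.dom_finite _).comp (Primrec.fst.comp hc)) ?_ ?_).of_eq ?_
  · refine (hact fun s => (M.actResult s).1).pair (primrec_pi fun i => ?_)
    exact primrec_listAct (hact fun s => ((M.actResult s).2 i).1)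
      (hact fun s => decide (((M.actResult s).2 i).2 = some .left))
      (hact fun s => decide (((M.actResult s).2 i).2 = some .right)) (ht i)
  · classical
    have hfst : Primrec (Prod.fst : (List Bool × M.ListCfg) × (M.State × M.State) → _) :=
      Primrec.fst
    exact (Primrec.ite (hq.comp hfst) (Primrec.fst.comp Primrec.snd)
      (Primrec.snd.comp Primrec.snd)).pair (Primrec.snd.comp (hc.comp hfst))
  · intro p
    dsimp only
    unfold listStep
    cases M.askTargets p.2.1 <;> rfl

theorem primrec_listInit : Primrec M.listInit := by
  refine (Primrec.const _).pair (primrec_pi fun i => (Primrec.const []).pair ?_)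
  by_cases h : i = 0
  · simp only [h, if_true]
    exact Primrec.list_map Primrec.id (Primrec.option_some.comp (Primrec.sumInl.comp Primrec.snd))
  · simp only [h, if_false]
    exact Primrec.const []

end Primrec

/-- The strings `σ` for which a computation with the sparse oracle given by `σ`, of a length for
which `σ` determines the oracle, has an output that is wrong for the language `L`. -/
def wrongSet (L : Language Bool) : Set (List Bool) :=
  {σ | ∃ (x : List Bool) (n : ℕ) (b : Bool), 2 * n ≤ 2 ^ σ.length ∧
    M.instr ((M.step (sparseLang (bitSet σ)))^[n] (M.init x)).state = .halt b ∧
    ¬ (b = true ↔ x ∈ L)}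

theorem rePred_wrongSet {L : Language Bool} (hL : IsComputable L) :
    REPred fun σ => σ ∈ M.wrongSet L := by
  classical
  have := M.finiteState
  have := M.finiteSymb
  obtain ⟨m, ⟨e⟩⟩ := Finite.exists_equiv_fin M.State
  obtain ⟨k, ⟨e'⟩⟩ := Finite.exists_equiv_fin M.Symb
  let _ : Primcodable M.State := Primcodable.ofEquiv _ e
  let _ : Primcodable M.Symb := Primcodable.ofEquiv _ e'
  let run : List Bool → List Bool × ℕ → Option Bool := fun σ p =>
    M.haltOutput ((M.listStep σ)^[p.2] (M.listInit p.1)).1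
  have hrun : Primrec₂ run := by
    refine (Primrec.dom_finite _).comp (Primrec.fst.comp (Primrec.nat_iterate
      (Primrec.snd.comp Primrec.snd) (M.primrec_listInit.comp (Primrec.fst.comp Primrec.snd)) ?_))
    exact M.primrec_listStep.comp (Primrec.fst.comp Primrec.fst) Primrec.snd
  have hre := rePred_exists (p := fun σ n => ∃ p ∈ decode (α := List Bool × ℕ) n, ∃ b ∈ run σ p,
      2 * p.2 ≤ 2 ^ σ.length ∧ ¬ (b = true ↔ p.1 ∈ L))
    (f := fun q => ((decode (α := List Bool × ℕ) q.2).bind fun p => (run q.1 p).map fun b =>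
      decide (2 * p.2 ≤ 2 ^ q.1.length) && (b != decide (p.1 ∈ L))).getD false) ?_ ?_
  · refine hre.of_eq fun σ => ?_
    constructor
    · rintro ⟨-, ⟨x, n⟩, -, b, hb, h1, h2⟩
      refine ⟨x, n, b, h1, ?_, h2⟩
      rw [iterate_step_eq]
      exact M.haltOutput_eq_some.1 hb
    · rintro ⟨x, n, b, h1, h2, h3⟩
      rw [iterate_step_eq] at h2
      exact ⟨encode (x, n), (x, n), Encodable.encodek _, b, M.haltOutput_eq_some.2 h2, h1, h3⟩
  · refine Computable.option_getD (Computable.option_bind (Computable.decode.comp Computable.snd)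
      (Computable.option_map (hrun.to_comp.comp (Computable.fst.comp Computable.fst)
        Computable.snd) ?_)) (Computable.const false)
    refine Primrec.and.to_comp.comp (Primrec.to_comp ?_) ((Primrec.dom_bool₂ _).to_comp.comp
      Computable.snd (hL.decide.comp (Computable.fst.comp (Computable.snd.comp Computable.fst))))
    exact (Primrec.nat_le.comp (Primrec.nat_mul.comp (Primrec.const 2) (Primrec.snd.comp
      (Primrec.snd.comp Primrec.fst))) (primrec_nat_pow.comp (Primrec.const 2)
        (Primrec.list_length.comp (Primrec.fst.comp (Primrec.fst.comp Primrec.fst))))).decide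
  · rintro ⟨σ, n⟩
    dsimp only
    cases decode (α := List Bool × ℕ) n with
    | none => simp
    | some p =>
      cases h : run σ p with
      | none => simp [h]
      | some b => by_cases hx : p.1 ∈ L <;> cases b <;> simp [h, hx]

end OracleTM

/-- If the computable language `L` is decided with the sparse oracle of a 1-generic set, then a
prefix of this set forces all outputs to be correct. -/
theorem IsOneGeneric.exists_forcing {G : Set ℕ} (hG : IsOneGeneric G) {L : Language Bool}
    (hL : IsComputable L) {M : OracleTM} {f : List Bool → ℕ}
    (hM : M.DecidesInTime (sparseLang G) L f) :
    ∃ σ, IsPrefixOf σ G ∧ ∀ τ x n b, σ <+: τ →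
      M.instr ((M.step (sparseLang (bitSet τ)))^[n] (M.init x)).state = .halt b →
        (b = true ↔ x ∈ L) := by
  obtain ⟨σ, hσ, h | h⟩ := hG _ (M.rePred_wrongSet hL)
  · obtain ⟨x, n, b, hn, hb, hx⟩ := h
    exfalso
    obtain ⟨b', ⟨m, -, hm⟩, hb'⟩ := hM x
    -- If a prefix of G were in the wrong set, the oracle it describes would agree with the true one
    -- on all words queried, so the true computation would be wrong too.
    rw [M.iterate_step_congr x (Y := sparseLang G)
      fun w hw => mem_sparseLang_congr hσ (by omega)] at hb
    -- Halting configurations are fixed, so after m + n steps both halting times show the same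
    -- configuration and the same output.
    have h1 := M.iterate_step_of_halt (X := sparseLang G) hb m
    have h2 := M.iterate_step_of_halt (X := sparseLang G) hm n
    rw [← Function.iterate_add_apply] at h1 h2
    rw [add_comm, h2] at h1
    rw [← h1, hm] at hb
    injection hb with hb
    exact hx (hb ▸ hb')
  · refine ⟨σ, hσ, fun τ x n b hτ hb => ?_⟩
    by_contra hx
    -- Padding with zeros leaves the described oracle unchanged and makes the string long enough for
    -- the length condition of `wrongSet`.
    refine h (τ ++ List.replicate (2 * n) false) (hτ.trans (List.prefix_append _ _))
      ⟨x, n, b, ?_, ?_, hx⟩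
    · have := Nat.lt_two_pow_self (n := (τ ++ List.replicate (2 * n) false).length)
      simp only [List.length_append, List.length_replicate] at this ⊢
      omega
    · have : bitSet (τ ++ List.replicate (2 * n) false) = bitSet τ := by
        ext k
        change _ = _ ↔ _ = _
        rw [List.getElem?_append]
        split_ifs with hk
        · rfl
        · rw [List.getElem?_eq_none (not_lt.1 hk)]
          simp [List.getElem?_replicate]
      rwa [this]

end LowForSpeed

/-! ### Machines with separate alphabets for work tapes, ruler and log, and their translation to
ordinary machines. -/

namespace LowForSpeed

open Turing (Tape ListBlank)

/-! ### Machines with tapes of three kinds -/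

/-- A deterministic machine without oracle with state set `Q`, with `k + 2` main tapes over
`Cell A`, one tape over `Option B` (the ruler) and one tape over `Option C` (the log). -/
structure MixedTM (Q A B C : Type) (k : ℕ) where
  start : Q
  out : Q → Option Bool
  next : Q → (Fin (k + 2) → Cell A) → Option B → Option C →
    Q × (Fin (k + 2) → Cell A × Option Turing.Dir) ×
      (Option B × Option Turing.Dir) × (Option C × Option Turing.Dir)

namespace MixedTM

variable {Q A B C : Type} {k : ℕ}

/-- A configuration of a machine with tapes of three kinds. -/
structure Cfg (Q A B C : Type) (k : ℕ) where
  state : Q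
  main : Fin (k + 2) → Tape (Cell A)
  ruler : Tape (Option B)
  log : Tape (Option C)

/-- Write a symbol on a tape and move its head. -/
def actOn {Γ : Type} [Inhabited Γ] (T : Tape Γ) (r : Γ × Option Turing.Dir) : Tape Γ :=
  match r.2 with
  | none => T.write r.1
  | some d => (T.write r.1).move d

/-- One step of computation. -/
def step (N : MixedTM Q A B C k) (c : Cfg Q A B C k) : Cfg Q A B C k :=
  match N.out c.state with
  | some _ => c
  | none =>
    let r := N.next c.state (fun i => (c.main i).head) c.ruler.head c.log.head
    { state := r.1
      main := fun i => actOn (c.main i) (r.2.1 i)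
      ruler := actOn c.ruler r.2.2.1
      log := actOn c.log r.2.2.2 }

/-- The embedding of the main alphabet. -/
def encMain (A B C : Type) : Turing.PointedMap (Cell A) (Cell (A ⊕ B ⊕ C)) :=
  ⟨Option.map (Sum.map id Sum.inl), rfl⟩

/-- The embedding of the ruler alphabet. -/
def encRuler (A B C : Type) : Turing.PointedMap (Option B) (Cell (A ⊕ B ⊕ C)) :=
  ⟨Option.map fun b => Sum.inr (Sum.inr (Sum.inl b)), rfl⟩

/-- The embedding of the log alphabet. -/
def encLog (A B C : Type) : Turing.PointedMap (Option C) (Cell (A ⊕ B ⊕ C)) :=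
  ⟨Option.map fun c => Sum.inr (Sum.inr (Sum.inr c)), rfl⟩

/-- A left inverse of the embedding of the main alphabet. -/
def decMain : Cell (A ⊕ B ⊕ C) → Cell A
  | some (Sum.inl b) => some (Sum.inl b)
  | some (Sum.inr (Sum.inl a)) => some (Sum.inr a)
  | _ => none

/-- A left inverse of the embedding of the ruler alphabet. -/
def decRuler : Cell (A ⊕ B ⊕ C) → Option B
  | some (Sum.inr (Sum.inr (Sum.inl b))) => some b
  | _ => none

/-- A left inverse of the embedding of the log alphabet. -/
def decLog : Cell (A ⊕ B ⊕ C) → Option C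
  | some (Sum.inr (Sum.inr (Sum.inr c))) => some c
  | _ => none

theorem decMain_encMain (a : Cell A) : decMain (encMain A B C a) = a := by
  rcases a with _ | (b | a) <;> rfl

theorem decRuler_encRuler (b : Option B) : decRuler (encRuler A B C b) = b := by
  cases b <;> rfl

theorem decLog_encLog (c : Option C) : decLog (encLog A B C c) = c := by
  cases c <;> rfl

/-- Combine the tapes of three kinds. -/
def combine {Γ : Type} (f : Fin (k + 2) → Γ) (a b : Γ) : Fin (k + 2 + 2) → Γ :=
  Fin.append f ![a, b]

theorem combine_castAdd {Γ : Type} (f : Fin (k + 2) → Γ) (a b : Γ) (i : Fin (k + 2)) :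
    combine f a b (Fin.castAdd 2 i) = f i := Fin.append_left _ _ _

theorem combine_natAdd_zero {Γ : Type} (f : Fin (k + 2) → Γ) (a b : Γ) :
    combine f a b (Fin.natAdd (k + 2) 0) = a := Fin.append_right _ _ _

theorem combine_natAdd_one {Γ : Type} (f : Fin (k + 2) → Γ) (a b : Γ) :
    combine f a b (Fin.natAdd (k + 2) 1) = b := Fin.append_right _ _ _

theorem eq_combine {Γ : Type} {g : Fin (k + 2 + 2) → Γ} {f : Fin (k + 2) → Γ} {a b : Γ}
    (h1 : ∀ i, g (Fin.castAdd 2 i) = f i) (h2 : g (Fin.natAdd (k + 2) 0) = a)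
    (h3 : g (Fin.natAdd (k + 2) 1) = b) : g = combine f a b := by
  funext i
  refine Fin.addCases (m := k + 2) (n := 2) (fun i => ?_) (fun i => ?_) i
  · rw [combine_castAdd, h1]
  · fin_cases i
    · exact h2.trans (combine_natAdd_zero f a b).symm
    · exact h3.trans (combine_natAdd_one f a b).symm

/-- The transition function of the ordinary machine. -/
def combinedNext (N : MixedTM Q A B C k) (q : Q) (s : Fin (k + 2 + 2) → Cell (A ⊕ B ⊕ C)) :
    Q × (Fin (k + 2 + 2) → Cell (A ⊕ B ⊕ C) × Option Turing.Dir) :=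
  let r := N.next q (fun i => decMain (s (Fin.castAdd 2 i)))
    (decRuler (s (Fin.natAdd (k + 2) 0))) (decLog (s (Fin.natAdd (k + 2) 1)))
  (r.1, combine (fun i => (encMain A B C (r.2.1 i).1, (r.2.1 i).2))
    (encRuler A B C r.2.2.1.1, r.2.2.1.2) (encLog A B C r.2.2.2.1, r.2.2.2.2))

/-- The ordinary machine that does the work of a machine with tapes of three kinds. -/
def toOracleTM [Finite A] [Finite B] [Finite C] (N : MixedTM Q A B C k) [Finite Q] :
    OracleTM where
  State := Q
  Symb := A ⊕ B ⊕ C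
  extraTapes := k + 2
  start := N.start
  instr q :=
    match N.out q with
    | some b => .halt b
    | none => .act (N.combinedNext q)

variable [Finite A] [Finite B] [Finite C] (N : MixedTM Q A B C k) [Finite Q]

theorem toOracleTM_instr_some {q : Q} {b : Bool} (h : N.out q = some b) :
    N.toOracleTM.instr q = .halt b := by
  simp only [toOracleTM, h]

theorem toOracleTM_instr_none {q : Q} (h : N.out q = none) :
    N.toOracleTM.instr q = .act (N.combinedNext q) := by
  simp only [toOracleTM, h]

theorem toOracleTM_oracleFree : N.toOracleTM.OracleFree := by
  intro q yes no h
  cases h' : N.out q with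
  | some b => rw [N.toOracleTM_instr_some h'] at h; cases h
  | none => rw [N.toOracleTM_instr_none h'] at h; cases h

/-- The configuration of the ordinary machine. -/
def toCfg (c : Cfg Q A B C k) : N.toOracleTM.Cfg where
  state := c.state
  tape := combine (fun i : Fin (k + 2) => (c.main i).map (encMain A B C))
    (c.ruler.map (encRuler A B C)) (c.log.map (encLog A B C))

theorem toCfg_tape_main (c : Cfg Q A B C k) (i : Fin (k + 2)) :
    (N.toCfg c).tape (Fin.castAdd 2 i) = (c.main i).map (encMain A B C) :=
  combine_castAdd (fun i : Fin (k + 2) => (c.main i).map (encMain A B C))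
    (c.ruler.map (encRuler A B C)) (c.log.map (encLog A B C)) i

theorem toCfg_tape_ruler (c : Cfg Q A B C k) :
    (N.toCfg c).tape (Fin.natAdd (k + 2) 0) = c.ruler.map (encRuler A B C) :=
  combine_natAdd_zero (fun i : Fin (k + 2) => (c.main i).map (encMain A B C))
    (c.ruler.map (encRuler A B C)) (c.log.map (encLog A B C))

theorem toCfg_tape_log (c : Cfg Q A B C k) :
    (N.toCfg c).tape (Fin.natAdd (k + 2) 1) = c.log.map (encLog A B C) :=
  combine_natAdd_one (fun i : Fin (k + 2) => (c.main i).map (encMain A B C))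
    (c.ruler.map (encRuler A B C)) (c.log.map (encLog A B C))

theorem moveHead_eq_map_actOn {Γ D : Type} [Inhabited Γ] (e : Turing.PointedMap Γ (Cell D))
    (T : Tape Γ) (r : Γ × Option Turing.Dir) {p : Cell D × Option Turing.Dir}
    {T' : Tape (Cell D)} (hp : p = (e r.1, r.2)) (hT : T' = T.map e) :
    moveHead p.2 (T'.write p.1) = (actOn T r).map e := by
  subst hp hT
  rcases r with ⟨a, _ | d⟩
  · simp [actOn, moveHead]
  · simp [actOn, moveHead, Tape.map_move]

theorem combinedNext_toCfg (c : Cfg Q A B C k) (q : Q) :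
    N.combinedNext q (fun i => ((N.toCfg c).tape i).head) =
      let r := N.next q (fun i => (c.main i).head) c.ruler.head c.log.head
      (r.1, combine (fun i => (encMain A B C (r.2.1 i).1, (r.2.1 i).2))
        (encRuler A B C r.2.2.1.1, r.2.2.1.2) (encLog A B C r.2.2.2.1, r.2.2.2.2)) := by
  have h1 : ∀ i, decMain ((N.toCfg c).tape (Fin.castAdd 2 i)).head = (c.main i).head := fun i =>
    (congrArg (fun T => decMain (Tape.head T)) (N.toCfg_tape_main c i)).trans
      ((congrArg decMain (Tape.map_fst _ _)).trans (decMain_encMain _))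
  have h2 : decRuler ((N.toCfg c).tape (Fin.natAdd (k + 2) 0)).head = c.ruler.head :=
    (congrArg (fun T => decRuler (Tape.head T)) (N.toCfg_tape_ruler c)).trans
      ((congrArg decRuler (Tape.map_fst _ _)).trans (decRuler_encRuler _))
  have h3 : decLog ((N.toCfg c).tape (Fin.natAdd (k + 2) 1)).head = c.log.head :=
    (congrArg (fun T => decLog (Tape.head T)) (N.toCfg_tape_log c)).trans
      ((congrArg decLog (Tape.map_fst _ _)).trans (decLog_encLog _))
  have h4 := congrArg₂ (fun m (p : Option B × Option C) => N.next q m p.1 p.2) (funext h1)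
    (congrArg₂ Prod.mk h2 h3)
  exact congrArg (fun r : Q × (Fin (k + 2) → Cell A × Option Turing.Dir) ×
      (Option B × Option Turing.Dir) × (Option C × Option Turing.Dir) =>
    (r.1, combine (fun i => (encMain A B C (r.2.1 i).1, (r.2.1 i).2))
        (encRuler A B C r.2.2.1.1, r.2.2.1.2) (encLog A B C r.2.2.2.1, r.2.2.2.2))) h4

/-- The correspondence is step for step, so running times transfer without any loss. The oracle X is
irrelevant because no query instruction occurs. -/
theorem step_toCfg (X : Language Bool) (c : Cfg Q A B C k) :
    N.toOracleTM.step X (N.toCfg c) = N.toCfg (N.step c) := by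
  unfold MixedTM.step
  cases h : N.out c.state with
  | some b => exact N.toOracleTM.step_of_halt (N.toOracleTM_instr_some h)
  | none =>
    refine (N.toOracleTM.step_of_act (N.toOracleTM_instr_none h)
      (N.combinedNext_toCfg c c.state)).trans ?_
    dsimp only
    generalize N.next c.state (fun i => (c.main i).head) c.ruler.head c.log.head = r
    refine congrArg (OracleTM.Cfg.mk (M := N.toOracleTM) r.1) (eq_combine (fun i => ?_) ?_ ?_)
    · exact moveHead_eq_map_actOn _ _ _ (combine_castAdd _ _ _ i)
        (N.toCfg_tape_main c i)
    · exact moveHead_eq_map_actOn _ _ _ (combine_natAdd_zero _ _ _)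
        (N.toCfg_tape_ruler c)
    · exact moveHead_eq_map_actOn _ _ _ (combine_natAdd_one _ _ _)
        (N.toCfg_tape_log c)

/-- The initial configuration. -/
def init (x : List Bool) : Cfg Q A B C k where
  state := N.start
  main i := if i = 0 then Tape.mk₁ (x.map fun b => some (Sum.inl b)) else default
  ruler := default
  log := default

theorem toCfg_init (x : List Bool) : N.toCfg (N.init x) = N.toOracleTM.init x := by
  refine congrArg (OracleTM.Cfg.mk (M := N.toOracleTM) N.start)
    (eq_combine (fun i => ?_) ?_ ?_).symm
  · have h0 : (Fin.castAdd 2 i : Fin (k + 2 + 2)) = 0 ↔ i = 0 := by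
      rw [Fin.ext_iff, Fin.ext_iff, Fin.val_castAdd]
      rfl
    by_cases h : i = 0
    · refine Eq.trans (if_pos (h0.2 h)) (Eq.trans ?_ (congrArg (Tape.map _) (if_pos h).symm))
      refine Eq.trans ?_ (Tape.map_mk₁ _ _).symm
      rw [List.map_map]
      rfl
    · exact Eq.trans (if_neg (mt h0.1 h)) (Eq.trans (b := Tape.map (encMain A B C) default) rfl
        (congrArg (Tape.map _) (if_neg h).symm))
  · exact if_neg fun h => absurd (congrArg Fin.val h) (Nat.succ_ne_zero _)
  · exact if_neg fun h => absurd (congrArg Fin.val h) (Nat.succ_ne_zero _)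

theorem haltsWithin_of_iterate {X : Language Bool} {x : List Bool} {b : Bool} {n t : ℕ}
    (hn : n ≤ t) (h : N.out (N.step^[n] (N.init x)).state = some b) :
    N.toOracleTM.HaltsWithin X x b t := by
  refine ⟨n, hn, ?_⟩
  have h1 : ∀ c, (N.toOracleTM.step X)^[n] (N.toCfg c) = N.toCfg (N.step^[n] c) := by
    intro c
    exact ((Function.Semiconj.iterate_right (f := N.toCfg)
      (fun c => (N.step_toCfg X c).symm) n) c).symm
  rw [← toCfg_init, h1]
  exact N.toOracleTM_instr_some h

end MixedTM
end LowForSpeed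

/-! ### The search machine: answering queries from the ruler, simulating steps and undoing them. -/

namespace LowForSpeed

open Turing (Tape ListBlank)

namespace MixedTM

variable {Q A B C : Type} {k : ℕ} (N : MixedTM Q A B C k)

/-- The configuration `c'` is reached from `c` in at most `n` steps. -/
def Reaches (n : ℕ) (c c' : Cfg Q A B C k) : Prop := ∃ m ≤ n, N.step^[m] c = c'

variable {N}

theorem Reaches.refl (c : Cfg Q A B C k) : N.Reaches 0 c c := ⟨0, le_rfl, rfl⟩

theorem Reaches.mono {m n : ℕ} {c c' : Cfg Q A B C k} (h : N.Reaches m c c') (hmn : m ≤ n) :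
    N.Reaches n c c' := by
  obtain ⟨l, hl, e⟩ := h
  exact ⟨l, hl.trans hmn, e⟩

theorem Reaches.trans {m n : ℕ} {c c' c'' : Cfg Q A B C k} (h : N.Reaches m c c')
    (h' : N.Reaches n c' c'') : N.Reaches (m + n) c c'' := by
  obtain ⟨l, hl, e⟩ := h
  obtain ⟨l', hl', e'⟩ := h'
  exact ⟨l' + l, by omega, by rw [Function.iterate_add_apply, e, e']⟩

theorem Reaches.of_step {c c' : Cfg Q A B C k} (h : N.step c = c') : N.Reaches 1 c c' :=
  ⟨1, le_rfl, h⟩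

theorem Reaches.of_next {q : Q} {S S' : Fin (k + 2) → Tape (Cell A)} {R R' : Tape (Option B)}
    {H H' : Tape (Option C)} {b : Option B} {c : Option C} {r} (h : N.out q = none)
    (hb : R.head = b) (hc : H.head = c) (hr : N.next q (fun i => (S i).head) b c = r)
    (hS : (fun i => actOn (S i) (r.2.1 i)) = S') (hR : actOn R r.2.2.1 = R')
    (hH : actOn H r.2.2.2 = H') : N.Reaches 1 ⟨q, S, R, H⟩ ⟨r.1, S', R', H'⟩ := by
  subst hb hc hr hS hR hH
  refine Reaches.of_step ?_
  simp only [step, h]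

theorem Reaches.of_next_eq {q q' : Q} {S S' : Fin (k + 2) → Tape (Cell A)}
    {R R' : Tape (Option B)} {H H' : Tape (Option C)} {b : Option B} {c : Option C} {m rb rc}
    (h : N.out q = none) (hb : R.head = b) (hc : H.head = c)
    (hr : N.next q (fun i => (S i).head) b c = (q', m, rb, rc))
    (hS : (fun i => actOn (S i) (m i)) = S') (hR : actOn R rb = R') (hH : actOn H rc = H') :
    N.Reaches 1 ⟨q, S, R, H⟩ ⟨q', S', R', H'⟩ :=
  .of_next h hb hc hr hS hR hH

end MixedTM

open MixedTM (actOn)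

/-! ### Head movements on tapes of marked cells -/

section Seg

variable {Γ : Type} [Inhabited Γ]

theorem actOn_head_none (T : Tape Γ) : actOn T (T.head, none) = T := T.write_self

theorem actOn_head_some (T : Tape Γ) (d : Turing.Dir) : actOn T (T.head, some d) = T.move d :=
  congrArg (Tape.move d) T.write_self

variable {B : Type}

/-- The tape of nonblank cells `u` (to the left of the head, the nearest one first) and `v`. -/
def seg (u v : List B) : Tape (Option B) := listTape (u.map some, v.map some)

/-- The tape of nonblank cells `u` and `v` with the head one cell to the left. -/
def segLeft (u v : List B) : Tape (Option B) := (seg u v).move .left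

theorem seg_head_cons (u v : List B) (b : B) : (seg u (b :: v)).head = some b := rfl

theorem seg_head_nil (u : List B) : (seg u []).head = none := rfl

theorem segLeft_cons (u v : List B) (b : B) : segLeft (b :: u) v = seg u (b :: v) := by
  rw [segLeft, seg, listTape_move_left]; rfl

/-- The blank to the left of the first cell is the marker at which every leftward sweep stops. -/
theorem segLeft_nil_head (v : List B) : (segLeft [] v).head = none := by
  rw [segLeft, seg, listTape_move_left]; rfl

theorem actOn_seg_right (u v : List B) (b c : B) :
    actOn (seg u (b :: v)) (some c, some .right) = seg (c :: u) v := by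
  simp only [actOn, seg]
  rw [listTape_write, listTape_move_right]; rfl

theorem actOn_seg_append (u : List B) (c : B) :
    actOn (seg u []) (some c, some .right) = seg (c :: u) [] := by
  simp only [actOn, seg]
  rw [listTape_write, listTape_move_right]; rfl

theorem actOn_seg_left (u v : List B) (b c : B) :
    actOn (seg u (b :: v)) (some c, some .left) = segLeft u (c :: v) := rfl

theorem actOn_seg_nil_left (u : List B) : actOn (seg u []) (none, some .left) = segLeft u [] :=
  actOn_head_some _ _

theorem actOn_seg_none (u v : List B) (b : B) :
    actOn (seg u (b :: v)) (some b, none) = seg u (b :: v) := actOn_head_none _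

theorem actOn_seg_nil_none (u : List B) : actOn (seg u []) (none, none) = seg u [] :=
  actOn_head_none _

theorem actOn_segLeft_nil (v : List B) :
    actOn (segLeft [] v) (none, some .right) = seg [] v := by
  have h := actOn_head_some (segLeft [] v) .right
  rw [segLeft_nil_head] at h
  rw [h, segLeft, Tape.move_left_right]

end Seg

/-! ### The search through all oracles -/

/-- The states of the machine that simulates `M` with all possible sparse oracles. -/
inductive SearchState (Q : Type) (n : ℕ) : Type
  | init (i : Fin (n + 1))
  | home
  | sim (q : Q)
  | scan (yes no : Q)
  | ret (q : Q)
  | back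
  | undo
  | incr
  | rewind
  | growRuler (first : Bool)
  | growLog (second : Bool)
  | homeLog

theorem SearchState.finite (Q : Type) (n : ℕ) [Finite Q] : Finite (SearchState Q n) := by
  let e : SearchState Q n → Fin 12 × Option (Fin (n + 1)) × Option Q × Option Q × Bool := fun s =>
    match s with
    | init i => (0, some i, none, none, false)
    | home => (1, none, none, none, false)
    | sim q => (2, none, some q, none, false)
    | scan y m => (3, none, some y, some m, false)
    | ret q => (4, none, some q, none, false)
    | back => (5, none, none, none, false)
    | undo => (6, none, none, none, false)
    | incr => (7, none, none, none, false)
    | rewind => (8, none, none, none, false)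
    | growRuler b => (9, none, none, none, b)
    | growLog b => (10, none, none, none, b)
    | homeLog => (11, none, none, none, false)
  refine Finite.of_injective e fun a b h => ?_
  cases a <;> cases b <;> simp_all [e]

/-- The opposite direction. -/
def oppositeDir : Turing.Dir → Turing.Dir
  | .left => .right
  | .right => .left

section Searcher

variable (M : OracleTM) (base : List (Bool × Bool))

/-- An entry of the log: the state of `M` and the scanned symbols before a step. -/
abbrev LogEntry : Type := M.State × (Fin (M.extraTapes + 2) → Cell M.Symb)

/-- Leave all tapes but tape `1` unchanged, and move on tape `1`. -/
def moveQuery {A : Type} {k : ℕ} (s : Fin (k + 2) → Cell A) (d : Turing.Dir)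
    (i : Fin (k + 2)) : Cell A × Option Turing.Dir :=
  (s i, if i = 1 then some d else none)

/-- Leave all tapes unchanged. -/
def keepTapes {A : Type} {k : ℕ} (s : Fin (k + 2) → Cell A) (i : Fin (k + 2)) :
    Cell A × Option Turing.Dir :=
  (s i, none)

/-- The transition function of the search. The cells `(m, b)` of the ruler describe the oracle
which contains the word `0 ^ j` if the `j`-th cell has `b = true`; the cells with `m = true` run
through all possible values. A cell `none` of the log permits one more simulated step. -/
def searchNext :
    SearchState M.State base.length → (Fin (M.extraTapes + 2) → Cell M.Symb) →
      Option (Bool × Bool) → Option (Option (LogEntry M)) →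
    SearchState M.State base.length × (Fin (M.extraTapes + 2) → Cell M.Symb × Option Turing.Dir) ×
      (Option (Bool × Bool) × Option Turing.Dir) × (Option (Option (LogEntry M)) × Option Turing.Dir)
  | .init i, s, r, h =>
    if hi : i.1 < base.length then
      (.init ⟨i + 1, Nat.succ_lt_succ hi⟩, keepTapes s, (some base[i.1], some .right),
        (some none, some .right))
    else (.home, keepTapes s, (r, some .left), (h, some .left))
  | .home, s, r, h =>
    match r with
    | some c => (.home, keepTapes s, (some c, some .left), (h, some .left))
    | none => (.sim M.start, keepTapes s, (none, some .right), (h, some .right))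
  | .sim q, s, r, h =>
    match h with
    | none => (.back, keepTapes s, (r, none), (none, some .left))
    | some _ =>
      match M.askTargets q with
      | some t => (.scan t.1 t.2, keepTapes s, (r, none), (some (some (q, s)), some .right))
      | none => (.sim (M.actResult (q, s)).1, (M.actResult (q, s)).2, (r, none),
          (some (some (q, s)), some .right))
  | .scan y n, s, r, h =>
    match s 1, r with
    | some (Sum.inl false), some c =>
      (.scan y n, moveQuery s .right, (some c, some .right), (h, none))
    | some (Sum.inl _), r => (.ret n, moveQuery s .left, (r, some .left), (h, none))
    | _, some (m, true) => (.ret y, moveQuery s .left, (some (m, true), some .left), (h, none))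
    | _, r => (.ret n, moveQuery s .left, (r, some .left), (h, none))
  | .ret q, s, r, h =>
    match r with
    | some c => (.ret q, moveQuery s .left, (some c, some .left), (h, none))
    | none => (.sim q, moveQuery s .right, (none, some .right), (h, none))
  | .back, s, r, h =>
    match h with
    | some (some e) =>
      (.undo, fun i => (s i, ((M.actResult e).2 i).2.map oppositeDir), (r, none),
        (some (some e), none))
    | h => (.incr, keepTapes s, (r, none), (h, some .right))
  | .undo, s, r, h =>
    match h with
    | some (some e) => (.back, fun i => (e.2 i, none), (r, none), (some none, some .left))
    | h => (.undo, keepTapes s, (r, none), (h, none))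
  | .incr, s, r, h =>
    match r with
    | none => (.growRuler true, keepTapes s, (none, none), (h, none))
    | some (false, b) => (.incr, keepTapes s, (some (false, b), some .right), (h, none))
    | some (true, true) => (.incr, keepTapes s, (some (true, false), some .right), (h, none))
    | some (true, false) => (.rewind, keepTapes s, (some (true, true), some .left), (h, none))
  | .rewind, s, r, h =>
    match r with
    | some c => (.rewind, keepTapes s, (some c, some .left), (h, none))
    | none => (.sim M.start, keepTapes s, (none, some .right), (h, none))
  | .growRuler f, s, r, h =>
    match h with
    | some e => (.growRuler false, keepTapes s, (some (f, false), some .right),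
        (some e, some .right))
    | none => (.growLog false, keepTapes s, (r, some .left), (none, none))
  | .growLog f, s, r, h =>
    match r, f with
    | some c, true => (.growLog false, keepTapes s, (some c, some .left), (some none, some .right))
    | some c, false => (.growLog true, keepTapes s, (some c, some .left), (h, none))
    | none, _ => (.homeLog, keepTapes s, (none, some .right), (h, some .left))
  | .homeLog, s, r, h =>
    match h with
    | some e => (.homeLog, keepTapes s, (r, none), (some e, some .left))
    | none => (.sim M.start, keepTapes s, (r, none), (none, some .right))

/-- The machine that simulates `M` with all possible sparse oracles. -/
def searcher : MixedTM (SearchState M.State base.length) M.Symb (Bool × Bool)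
    (Option (LogEntry M)) M.extraTapes where
  start := .init 0
  out
    | .sim q => M.haltOutput q
    | _ => none
  next := searchNext M base

theorem actOn_keepTapes {A : Type} {k : ℕ} (S : Fin (k + 2) → Tape (Cell A)) :
    (fun i => actOn (S i) (keepTapes (fun i => (S i).head) i)) = S :=
  funext fun i => actOn_head_none (S i)

theorem actOn_moveQuery {A : Type} {k : ℕ} (S : Fin (k + 2) → Tape (Cell A)) (T : Tape (Cell A))
    (d : Turing.Dir) :
    (fun i => actOn (Function.update S 1 T i)
      (moveQuery (fun i => (Function.update S 1 T i).head) d i)) =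
        Function.update S 1 (T.move d) := by
  funext i
  by_cases h : i = 1
  · subst h
    simp only [moveQuery, if_true, actOn_head_some, Function.update_self]
  · simp only [moveQuery, h, if_false, actOn_head_none, Function.update_of_ne h]

variable {M base}

/-- Abbreviation for the configurations of the search. -/
abbrev SCfg (M : OracleTM) (base : List (Bool × Bool)) : Type :=
  MixedTM.Cfg (SearchState M.State base.length) M.Symb (Bool × Bool) (Option (LogEntry M))
    M.extraTapes

variable {S : Fin (M.extraTapes + 2) → Tape (Cell M.Symb)} {R : Tape (Option (Bool × Bool))}
  {H : Tape (Option (Option (LogEntry M)))}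

/-! #### Answering queries -/

/-- The ruler measures how far the query head has to go back: both heads move left together,
overshoot the start by one cell, and return by one. -/
theorem reaches_ret (q : M.State) (u v : List (Bool × Bool)) (T : Tape (Cell M.Symb)) :
    (searcher M base).Reaches (u.length + 1)
      ⟨.ret q, Function.update S 1 (T.move .left), segLeft u v, H⟩
      ⟨.sim q, Function.update S 1 ((Tape.move .left)^[u.length] T), seg [] (u.reverse ++ v), H⟩ := by
  induction u generalizing v T with
  | nil =>
    have h : (searcher M base).Reaches 1
        ⟨.ret q, Function.update S 1 (T.move .left), segLeft [] v, H⟩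
        ⟨.sim q, Function.update S 1 ((T.move .left).move .right), seg [] v, H⟩ :=
      .of_next rfl (segLeft_nil_head v) rfl rfl (actOn_moveQuery S _ .right) (actOn_segLeft_nil v)
        (actOn_head_none H)
    rwa [Tape.move_left_right] at h
  | cons b u ih =>
    have h : (searcher M base).Reaches 1
        ⟨.ret q, Function.update S 1 (T.move .left), segLeft (b :: u) v, H⟩
        ⟨.ret q, Function.update S 1 ((T.move .left).move .left), segLeft u (b :: v), H⟩ := by
      rw [segLeft_cons]
      exact .of_next rfl (seg_head_cons u v b) rfl rfl (actOn_moveQuery S _ .left)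
        (actOn_seg_left u v b b) (actOn_head_none H)
    have h' := (h.trans (ih (b :: v) (T.move .left))).mono (n := (b :: u).length + 1)
      (by simp; omega)
    simpa [Function.iterate_succ_apply] using h'

/-- The oracle described by the cells of the ruler. -/
def rulerOracle (v : List (Bool × Bool)) : Language Bool :=
  {w | ∃ j, w = List.replicate j false ∧ ∃ m, v[j]? = some (m, true)}

theorem nil_mem_rulerOracle {v : List (Bool × Bool)} :
    [] ∈ rulerOracle v ↔ ∃ m, v[0]? = some (m, true) := by
  constructor
  · rintro ⟨j, hj, h⟩
    cases j with
    | zero => exact h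
    | succ j => cases hj
  · exact fun h => ⟨0, rfl, h⟩

theorem false_cons_mem_rulerOracle {c : Bool × Bool} {v : List (Bool × Bool)} {w : List Bool} :
    false :: w ∈ rulerOracle (c :: v) ↔ w ∈ rulerOracle v := by
  constructor
  · rintro ⟨j, hj, h⟩
    cases j with
    | zero => cases hj
    | succ j => exact ⟨j, by simpa [List.replicate_succ] using hj, by simpa using h⟩
  · rintro ⟨j, rfl, h⟩
    exact ⟨j + 1, rfl, by simpa using h⟩

theorem true_cons_notMem_rulerOracle {v : List (Bool × Bool)} {w : List Bool} :
    true :: w ∉ rulerOracle v := by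
  rintro ⟨j, hj, -⟩
  cases j <;> simp [List.replicate_succ] at hj

theorem notMem_rulerOracle_nil {w : List Bool} : w ∉ rulerOracle [] := by
  rintro ⟨j, -, m, h⟩
  simp at h

theorem queryWord_cons {A : Type} {T : Tape (Cell A)} {b : Bool}
    (h : T.head = some (Sum.inl b)) : queryWord T = b :: queryWord (T.move .right) := by
  obtain ⟨⟨L, r⟩, rfl⟩ := exists_listTape T
  rw [listTape_move_right, queryWord_listTape, queryWord_listTape]
  rw [listTape_head] at h
  cases r with
  | nil => cases h
  | cons a r => obtain rfl : a = _ := h; rfl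

theorem queryWord_nil {A : Type} {T : Tape (Cell A)}
    (h : ∀ b, T.head ≠ some (Sum.inl b)) : queryWord T = [] := by
  obtain ⟨⟨L, r⟩, rfl⟩ := exists_listTape T
  rw [queryWord_listTape]
  rcases r with _ | ⟨_ | (b | a), r⟩
  · rfl
  · rfl
  · exact absurd rfl (h b)
  · rfl

section ScanRules

variable {y n : M.State} {s : Fin (M.extraTapes + 2) → Cell M.Symb}
  {h : Option (Option (LogEntry M))}

theorem searchNext_scan_zero {c : Bool × Bool} (hs : s 1 = some (Sum.inl false)) :
    searchNext M base (.scan y n) s (some c) h =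
      (.scan y n, moveQuery s .right, (some c, some .right), (h, none)) := by
  simp only [searchNext, hs]

theorem searchNext_scan_zero_end (hs : s 1 = some (Sum.inl false)) :
    searchNext M base (.scan y n) s none h =
      (.ret n, moveQuery s .left, (none, some .left), (h, none)) := by
  simp only [searchNext, hs]

theorem searchNext_scan_one {r : Option (Bool × Bool)} (hs : s 1 = some (Sum.inl true)) :
    searchNext M base (.scan y n) s r h =
      (.ret n, moveQuery s .left, (r, some .left), (h, none)) := by
  simp only [searchNext, hs]

theorem searchNext_scan_end_true {m : Bool} (hs : ∀ b, s 1 ≠ some (Sum.inl b)) :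
    searchNext M base (.scan y n) s (some (m, true)) h =
      (.ret y, moveQuery s .left, (some (m, true), some .left), (h, none)) := by
  simp only [searchNext]
  split <;> simp_all

theorem searchNext_scan_end_false {r : Option (Bool × Bool)} (hs : ∀ b, s 1 ≠ some (Sum.inl b))
    (hr : ∀ m, r ≠ some (m, true)) :
    searchNext M base (.scan y n) s r h =
      (.ret n, moveQuery s .left, (r, some .left), (h, none)) := by
  simp only [searchNext]
  split <;> simp_all

end ScanRules

-- Query head and ruler head advance in lockstep over zeros, so at the end of the word the ruler
-- head is on the cell for its length. A bit 1, or a word that outruns the ruler, means a negative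
-- answer. The list u holds the cells already passed.
open Classical in
theorem reaches_scan (y n : M.State) (u v : List (Bool × Bool)) (T : Tape (Cell M.Symb)) :
    (searcher M base).Reaches (u.length + 2 * v.length + 2)
      ⟨.scan y n, Function.update S 1 T, seg u v, H⟩
      ⟨.sim (if queryWord T ∈ rulerOracle v then y else n),
        Function.update S 1 ((Tape.move .left)^[u.length] T), seg [] (u.reverse ++ v), H⟩ := by
  have hu : (Function.update S 1 T 1).head = T.head := by rw [Function.update_self]
  -- Every way of settling the answer is followed by the same return sweep.
  have hret : ∀ (q : M.State) (r : Option (Bool × Bool)), (seg u v).head = r →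
      searchNext M base (.scan y n) (fun i => (Function.update S 1 T i).head) r H.head =
        (.ret q, moveQuery (fun i => (Function.update S 1 T i).head) .left, (r, some .left),
          (H.head, none)) →
      (searcher M base).Reaches (u.length + 2 * v.length + 2)
        ⟨.scan y n, Function.update S 1 T, seg u v, H⟩
        ⟨.sim q, Function.update S 1 ((Tape.move .left)^[u.length] T), seg [] (u.reverse ++ v),
          H⟩ := by
    rintro q _ rfl hq
    refine (MixedTM.Reaches.trans (.of_next_eq rfl rfl rfl hq (actOn_moveQuery S T .left)
      (actOn_head_some _ _) (actOn_head_none H)) (reaches_ret q u v T)).mono (by omega)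
  by_cases h : ∃ b, T.head = some (Sum.inl b)
  · obtain ⟨b, hb⟩ := h
    rw [queryWord_cons hb]
    cases b with
    | true =>
      rw [if_neg true_cons_notMem_rulerOracle]
      exact hret n _ rfl (searchNext_scan_one (hu.trans hb))
    | false =>
      cases v with
      | nil =>
        rw [if_neg notMem_rulerOracle_nil]
        exact hret n _ rfl (searchNext_scan_zero_end (hu.trans hb))
      | cons c v =>
        simp only [false_cons_mem_rulerOracle]
        have h0 : searchNext M base (.scan y n) (fun i => (Function.update S 1 T i).head)
            (some c) H.head = (.scan y n, moveQuery (fun i => (Function.update S 1 T i).head) .right,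
              (some c, some .right), (H.head, none)) := searchNext_scan_zero (hu.trans hb)
        have h1 : (searcher M base).Reaches 1
            ⟨.scan y n, Function.update S 1 T, seg u (c :: v), H⟩
            ⟨.scan y n, Function.update S 1 (T.move .right), seg (c :: u) v, H⟩ :=
          .of_next_eq rfl (seg_head_cons u v c) rfl h0
            (actOn_moveQuery S T .right) (actOn_seg_right u v c c) (actOn_head_none H)
        have h2 := (h1.trans (reaches_scan y n (c :: u) v (T.move .right))).mono
          (n := u.length + 2 * (c :: v).length + 2) (by simp; omega)
        simpa [Function.iterate_succ_apply] using h2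
  · push Not at h
    rw [queryWord_nil h]
    have hu' : ∀ b, (Function.update S 1 T 1).head ≠ some (Sum.inl b) := by rwa [hu]
    by_cases hm : [] ∈ rulerOracle v
    · rw [if_pos hm]
      obtain ⟨m, hm⟩ := nil_mem_rulerOracle.1 hm
      cases v with
      | nil => simp at hm
      | cons c v =>
        obtain rfl : c = (m, true) := by simpa using hm
        exact hret y _ rfl (searchNext_scan_end_true hu')
    · rw [if_neg hm]
      refine hret n _ rfl (searchNext_scan_end_false hu' fun m hr => hm ?_)
      refine nil_mem_rulerOracle.2 ⟨m, ?_⟩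
      cases v with
      | nil => cases hr
      | cons c v => exact hr
termination_by v.length

/-! #### Simulation of steps, and their reversal -/

theorem moveHead_eq_actOn {A : Type} (T : Tape (Cell A)) (r : Cell A × Option Turing.Dir) :
    moveHead r.2 (T.write r.1) = actOn T r := by
  rcases r with ⟨a, _ | d⟩ <;> rfl

/-- The log entry for the next step. -/
def logEntry (c : M.Cfg) : LogEntry M := (c.state, fun i => (c.tape i).head)

/-- The change of the tapes depends on the log entry alone and not on the oracle's answer, since
queries leave the tapes alone. Hence the log suffices for undoing. -/
theorem step_tape (X : Language Bool) (c : M.Cfg) :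
    (M.step X c).tape = fun i => actOn (c.tape i) ((M.actResult (logEntry c)).2 i) := by
  unfold OracleTM.step
  split
  · rename_i δ h
    have h1 : M.actResult (logEntry c) = δ fun i => (c.tape i).head := by
      simp [OracleTM.actResult, logEntry, h]
    funext i
    rw [h1, ← moveHead_eq_actOn]
  · rename_i yes no h
    have h1 : M.actResult (logEntry c) = (c.state, fun i => ((c.tape i).head, none)) := by
      simp [OracleTM.actResult, logEntry, h]
    funext i
    rw [h1, actOn_head_none]
  · rename_i b h
    have h1 : M.actResult (logEntry c) = (c.state, fun i => ((c.tape i).head, none)) := by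
      simp [OracleTM.actResult, logEntry, h]
    funext i
    rw [h1, actOn_head_none]

/-- A step writes before it moves, so its reversal must move before it writes. This takes two steps,
the states `back` and `undo`. -/
theorem undo_actOn {Γ : Type} [Inhabited Γ] (T : Tape Γ) (r : Γ × Option Turing.Dir) :
    actOn (actOn (actOn T r) ((actOn T r).head, r.2.map oppositeDir)) (T.head, none) = T := by
  have h : ∀ a, actOn (T.write a) (T.head, none) = T := fun a => by cases T; rfl
  rcases r with ⟨a, _ | d | d⟩
  · rw [Option.map_none, actOn_head_none]; exact h a
  · rw [Option.map_some, actOn_head_some]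
    change actOn (((T.write a).move .left).move .right) _ = _
    rw [Tape.move_left_right, h]
  · rw [Option.map_some, actOn_head_some]
    change actOn (((T.write a).move .right).move .left) _ = _
    rw [Tape.move_right_left, h]

theorem reaches_sim_step (c : M.Cfg) (hc : M.haltOutput c.state = none) (l : List (Bool × Bool))
    (u v : List (Option (LogEntry M))) :
    (searcher M base).Reaches (2 * l.length + 3)
      ⟨.sim c.state, c.tape, seg [] l, seg u (none :: v)⟩
      ⟨.sim (M.step (rulerOracle l) c).state, (M.step (rulerOracle l) c).tape, seg [] l,
        seg (some (logEntry c) :: u) v⟩ := by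
  cases hi : M.instr c.state with
  | act δ =>
    have h1 : M.askTargets c.state = none := by simp [OracleTM.askTargets, hi]
    have h2 : M.actResult (logEntry c) = δ fun i => (c.tape i).head := by
      simp [OracleTM.actResult, logEntry, hi]
    have h3 : (M.step (rulerOracle l) c).state = (M.actResult (logEntry c)).1 := by
      rw [M.step_of_act hi rfl, h2]
    have h4 : searchNext M base (.sim c.state) (fun i => (c.tape i).head) (seg [] l).head
        (some none) = (.sim (M.actResult (logEntry c)).1, (M.actResult (logEntry c)).2,
          ((seg [] l).head, none), (some (some (logEntry c)), some .right)) := by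
      simp only [searchNext, h1]
      rfl
    rw [h3, step_tape]
    exact (MixedTM.Reaches.of_next_eq hc rfl (seg_head_cons u v none) h4 rfl (actOn_head_none _)
      (actOn_seg_right u v none _)).mono (by omega)
  | ask yes no =>
    have h1 : M.askTargets c.state = some (yes, no) := by simp [OracleTM.askTargets, hi]
    have h4 : searchNext M base (.sim c.state) (fun i => (c.tape i).head) (seg [] l).head
        (some none) = (.scan yes no, keepTapes (fun i => (c.tape i).head),
          ((seg [] l).head, none), (some (some (logEntry c)), some .right)) := by
      simp only [searchNext, h1]
      rfl
    have h5 : (searcher M base).Reaches 1 ⟨.sim c.state, c.tape, seg [] l, seg u (none :: v)⟩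
        ⟨.scan yes no, c.tape, seg [] l, seg (some (logEntry c) :: u) v⟩ :=
      .of_next_eq hc rfl (seg_head_cons u v none) h4 (actOn_keepTapes _) (actOn_head_none _)
        (actOn_seg_right u v none _)
    have h6 := reaches_scan (base := base) (S := c.tape) (H := seg (some (logEntry c) :: u) v)
      yes no [] l (c.tape 1)
    rw [Function.update_eq_self] at h6
    have h7 := (h5.trans h6).mono (n := 2 * l.length + 3) (by simp; omega)
    simp only [List.length_nil, Function.iterate_zero, id_eq, Function.update_eq_self,
      List.reverse_nil, List.nil_append] at h7
    have h8 := M.step_of_ask (X := rulerOracle l) hi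
    rw [h8]
    exact h7
  | halt b =>
    rw [M.haltOutput_eq_some.2 hi] at hc
    cases hc

/-- The log of the first `t` steps, the last one first. -/
noncomputable def logOf (X : Language Bool) (c : M.Cfg) : ℕ → List (Option (LogEntry M))
  | 0 => []
  | t + 1 => some (logEntry ((M.step X)^[t] c)) :: logOf X c t

/-- The free cells of the log are the remaining budget: t of them are consumed and j are left. -/
theorem reaches_sim (c : M.Cfg) {l : List (Bool × Bool)} {n : ℕ} (hl : l.length = n) (t j : ℕ)
    (h : ∀ s < t, M.haltOutput ((M.step (rulerOracle l))^[s] c).state = none) :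
    (searcher M base).Reaches (t * (2 * n + 3))
      ⟨.sim c.state, c.tape, seg [] l, seg [] (List.replicate (t + j) none)⟩
      ⟨.sim ((M.step (rulerOracle l))^[t] c).state, ((M.step (rulerOracle l))^[t] c).tape,
        seg [] l, seg (logOf (rulerOracle l) c t) (List.replicate j none)⟩ := by
  subst hl
  induction t generalizing j with
  | zero =>
    rw [Nat.zero_mul, Nat.zero_add]
    exact .refl _
  | succ t ih =>
    have h1 := ih (j + 1) fun s hs => h s (by omega)
    have h2 := reaches_sim_step (base := base) _ (h t t.lt_succ_self) l
      (logOf (rulerOracle l) c t) (List.replicate j none)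
    rw [← Function.iterate_succ_apply' (M.step (rulerOracle l))] at h2
    rw [Nat.succ_mul, show t + 1 + j = t + (j + 1) by omega]
    exact h1.trans h2

/-- Reversal restores the original tapes, input included, and frees the log cells again. Its cost is
linear in the number of simulated steps, independently of the input length. -/
theorem reaches_back (X : Language Bool) (c : M.Cfg) (t : ℕ) (v : List (Option (LogEntry M))) :
    (searcher M base).Reaches (2 * t + 1)
      ⟨.back, ((M.step X)^[t] c).tape, R, segLeft (logOf X c t) v⟩
      ⟨.incr, c.tape, R, seg [] (List.replicate t none ++ v)⟩ := by
  induction t generalizing v with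
  | zero =>
    exact .of_next rfl rfl (segLeft_nil_head v) rfl (actOn_keepTapes _) (actOn_head_none R)
      (actOn_segLeft_nil v)
  | succ t ih =>
    set e := logEntry ((M.step X)^[t] c) with he
    rw [Function.iterate_succ_apply', step_tape, logOf, segLeft_cons, ← he]
    have h1 : (searcher M base).Reaches 1
        ⟨.back, fun i => actOn (((M.step X)^[t] c).tape i) ((M.actResult e).2 i), R,
          seg (logOf X c t) (some e :: v)⟩
        ⟨.undo, fun i => actOn (actOn (((M.step X)^[t] c).tape i) ((M.actResult e).2 i))
            ((actOn (((M.step X)^[t] c).tape i) ((M.actResult e).2 i)).head,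
              ((M.actResult e).2 i).2.map oppositeDir), R, seg (logOf X c t) (some e :: v)⟩ :=
      .of_next rfl rfl (seg_head_cons _ v _) rfl rfl (actOn_head_none R) (actOn_seg_none _ _ _)
    have h2 : (searcher M base).Reaches 1
        ⟨.undo, fun i => actOn (actOn (((M.step X)^[t] c).tape i) ((M.actResult e).2 i))
            ((actOn (((M.step X)^[t] c).tape i) ((M.actResult e).2 i)).head,
              ((M.actResult e).2 i).2.map oppositeDir), R, seg (logOf X c t) (some e :: v)⟩
        ⟨.back, ((M.step X)^[t] c).tape, R, segLeft (logOf X c t) (none :: v)⟩ :=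
      .of_next rfl rfl (seg_head_cons _ v _) rfl (funext fun i => undo_actOn _ _)
        (actOn_head_none R) (actOn_seg_left _ _ _ _)
    have h3 := ((h1.trans h2).trans (ih (none :: v))).mono (n := 2 * (t + 1) + 1) (by omega)
    rwa [List.replicate_succ', List.append_assoc]

end Searcher

end LowForSpeed

/-! ### The ruler as a sparse oracle and as a binary counter. -/

namespace LowForSpeed

open Turing (Tape ListBlank)
open MixedTM (actOn)

/-! ### The cells of the ruler -/

/-- The cells that hold the entries `p` of a list, the `i`-th entry at position `2 ^ (n + i)` if
the first cell has position `2 ^ n`. -/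
def markCells : ℕ → List (Bool × Bool) → List (Bool × Bool)
  | _, [] => []
  | n, p :: l => p :: (List.replicate (2 ^ n - 1) (false, false) ++ markCells (n + 1) l)

theorem length_markCells (n : ℕ) (l : List (Bool × Bool)) :
    (markCells n l).length + 2 ^ n = 2 ^ (n + l.length) := by
  induction l generalizing n with
  | nil => simp [markCells]
  | cons p l ih =>
    have h := ih (n + 1)
    have h1 : 1 ≤ 2 ^ n := Nat.one_le_two_pow
    rw [pow_succ] at h
    rw [markCells, List.length_cons, List.length_append, List.length_replicate, List.length_cons,
      show n + (l.length + 1) = n + 1 + l.length by omega, ← h]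
    omega

theorem markCells_append (n : ℕ) (l l' : List (Bool × Bool)) :
    markCells n (l ++ l') = markCells n l ++ markCells (n + l.length) l' := by
  induction l generalizing n with
  | nil => simp [markCells]
  | cons p l ih =>
    rw [List.cons_append, markCells, markCells, ih, List.length_cons,
      show n + 1 + l.length = n + (l.length + 1) by omega]
    simp

/-- The absolute position of the j-th cell is j + 2 ^ n. The gap of 2 ^ n - 1 cells after an entry
takes the next entry to position 2 ^ (n + 1). -/
theorem markCells_getElem? (n j : ℕ) (l : List (Bool × Bool)) :
    (∃ m, (markCells n l)[j]? = some (m, true)) ↔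
      ∃ i, (∃ m, l[i]? = some (m, true)) ∧ j + 2 ^ n = 2 ^ (n + i) := by
  induction l generalizing n j with
  | nil => simp [markCells]
  | cons p l ih =>
    have h1 : 1 ≤ 2 ^ n := Nat.one_le_two_pow
    have h2 : ∀ i, 2 ^ n + 2 ^ n ≤ 2 ^ (n + (i + 1)) := fun i => by
      calc 2 ^ n + 2 ^ n = 2 ^ (n + 1) := by rw [pow_succ]; omega
        _ ≤ 2 ^ (n + (i + 1)) := Nat.pow_le_pow_right two_pos (by omega)
    rw [markCells]
    rcases j with _ | j
    · constructor
      · exact fun h => ⟨0, by simpa using h, by simp⟩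
      · rintro ⟨_ | i, h, h3⟩
        · simpa using h
        · have := h2 i
          omega
    · by_cases hj : j < 2 ^ n - 1
      · rw [List.getElem?_cons_succ, List.getElem?_append_left (by simpa using hj),
          List.getElem?_replicate_of_lt hj]
        constructor
        · rintro ⟨m, h⟩
          simp at h
        · rintro ⟨_ | i, -, h3⟩
          · simp at h3
          · have := h2 i
            omega
      · rw [List.getElem?_cons_succ, List.getElem?_append_right (by simpa using hj),
          List.length_replicate, ih, pow_succ]
        constructor
        · rintro ⟨i, h, h3⟩
          refine ⟨i + 1, by simpa using h, ?_⟩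
          rw [show n + (i + 1) = n + 1 + i by omega, ← h3]
          omega
        · rintro ⟨_ | i, h, h3⟩
          · simp at h3
          · refine ⟨i, by simpa using h, ?_⟩
            rw [show n + 1 + i = n + (i + 1) by omega, ← h3]
            omega

/-- The ruler for the oracle of the string `σ ++ ρ`, in which the bits of `ρ` may change. -/
def rulerOf (σ ρ : List Bool) : List (Bool × Bool) :=
  (false, false) :: markCells 0 (σ.map (Prod.mk false) ++ ρ.map (Prod.mk true))

theorem length_rulerOf (σ ρ : List Bool) :
    (rulerOf σ ρ).length = 2 ^ (σ.length + ρ.length) := by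
  have h := length_markCells 0 (σ.map (Prod.mk false) ++ ρ.map (Prod.mk true))
  simpa [rulerOf] using h

theorem rulerOf_eq_append (σ ρ : List Bool) :
    rulerOf σ ρ = rulerOf σ [] ++ markCells σ.length (ρ.map (Prod.mk true)) := by
  simp [rulerOf, markCells_append]

/-- The extra first cell of the ruler stands for the empty word; after it, the bit i of σ ++ ρ sits
exactly at position 2 ^ i. -/
theorem rulerOracle_rulerOf (σ ρ : List Bool) :
    rulerOracle (rulerOf σ ρ) = sparseLang (bitSet (σ ++ ρ)) := by
  have h0 : ∀ i, (∃ m, (σ.map (Prod.mk false) ++ ρ.map (Prod.mk true))[i]? = some (m, true)) ↔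
      i ∈ bitSet (σ ++ ρ) := by
    intro i
    have h1 : σ ++ ρ = (σ.map (Prod.mk false) ++ ρ.map (Prod.mk true)).map Prod.snd := by
      simp [Function.comp_def]
    change _ ↔ (σ ++ ρ)[i]? = some true
    rw [h1, List.getElem?_map]
    simp [Option.map_eq_some_iff]
  ext w
  constructor
  · rintro ⟨_ | j, rfl, m, h⟩
    · simp [rulerOf] at h
    · obtain ⟨i, hi, e⟩ := (markCells_getElem? 0 j _).1 ⟨m, by simpa [rulerOf] using h⟩
      exact ⟨i, (h0 i).1 hi, by rw [show j + 1 = 2 ^ i by simpa using e]⟩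
  · rintro ⟨i, hi, rfl⟩
    have h1 : 2 ^ i - 1 + 1 = 2 ^ i := Nat.sub_add_cancel Nat.one_le_two_pow
    obtain ⟨m, h⟩ := (markCells_getElem? 0 (2 ^ i - 1) _).2 ⟨i, (h0 i).2 hi, by simpa using h1⟩
    refine ⟨2 ^ i - 1 + 1, by rw [h1], m, ?_⟩
    simpa [rulerOf] using h

theorem fst_eq_false_of_mem_markCells {n : ℕ} {l : List (Bool × Bool)}
    (hl : ∀ a ∈ l, a.1 = false) : ∀ a ∈ markCells n l, a.1 = false := by
  induction l generalizing n with
  | nil => simp [markCells]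
  | cons p l ih =>
    intro a ha
    rw [markCells, List.mem_cons, List.mem_append] at ha
    rcases ha with rfl | ha | ha
    · exact hl _ List.mem_cons_self
    · rw [List.eq_of_mem_replicate ha]
    · exact ih (fun b hb => hl b (List.mem_cons_of_mem _ hb)) a ha

theorem fst_eq_false_of_mem_rulerOf_nil {σ : List Bool} {a : Bool × Bool}
    (ha : a ∈ rulerOf σ []) : a.1 = false := by
  rcases List.mem_cons.1 ha with rfl | ha
  · rfl
  · refine fst_eq_false_of_mem_markCells (fun b hb => ?_) a ha
    obtain ⟨c, -, rfl⟩ : ∃ c ∈ σ, (false, c) = b := by simpa using hb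
    rfl

/-! ### Counting through all strings -/

/-- The next string, in an order in which the shorter strings come first. -/
def binSucc : List Bool → List Bool
  | [] => [false]
  | false :: ρ => true :: ρ
  | true :: ρ => false :: binSucc ρ

/-- The position of a string in this order, counted from `1`. -/
def binIndex : List Bool → ℕ
  | [] => 1
  | b :: ρ => b.toNat + 2 * binIndex ρ

/-- A string is read as a binary number, least significant bit first, with an additional leading 1.
Passing from 1...1 to a longer 0...0 is then an ordinary carry. -/
theorem binIndex_binSucc (ρ : List Bool) : binIndex (binSucc ρ) = binIndex ρ + 1 := by
  fun_induction binSucc ρ <;> simp_all [binIndex]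
  all_goals omega

theorem one_le_binIndex (ρ : List Bool) : 1 ≤ binIndex ρ := by
  induction ρ with
  | nil => exact le_rfl
  | cons b ρ ih => rw [binIndex]; omega

theorem binIndex_injective : Function.Injective binIndex := by
  intro ρ
  induction ρ with
  | nil =>
    rintro (_ | ⟨b, ρ'⟩) h
    · rfl
    · have := one_le_binIndex ρ'
      rw [binIndex, binIndex] at h
      omega
  | cons b ρ ih =>
    rintro (_ | ⟨b', ρ'⟩) h
    · have := one_le_binIndex ρ
      rw [binIndex, binIndex] at h
      omega
    · rw [binIndex, binIndex] at h
      have h1 : b.toNat ≤ 1 := b.toNat_le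
      have h2 : b'.toNat ≤ 1 := b'.toNat_le
      obtain rfl : ρ = ρ' := ih (by omega)
      obtain rfl : b = b' := by
        cases b <;> cases b' <;> simp at h ⊢
      rfl

theorem binIndex_lt (ρ : List Bool) : binIndex ρ < 2 ^ (ρ.length + 1) := by
  induction ρ with
  | nil => simp [binIndex]
  | cons b ρ ih =>
    have := b.toNat_le
    rw [binIndex, List.length_cons, pow_succ]
    omega

theorem two_pow_length_le_binIndex (ρ : List Bool) : 2 ^ ρ.length ≤ binIndex ρ := by
  induction ρ with
  | nil => simp [binIndex]
  | cons b ρ ih =>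
    rw [binIndex, List.length_cons, pow_succ]
    omega

/-- Rounds before a given one are no more expensive, since their strings are not longer. -/
theorem length_le_of_binIndex_le {ρ ρ' : List Bool} (h : binIndex ρ ≤ binIndex ρ') :
    ρ.length ≤ ρ'.length := by
  have h1 := (two_pow_length_le_binIndex ρ).trans_lt (h.trans_lt (binIndex_lt ρ'))
  have := (Nat.pow_lt_pow_iff_right (a := 2) (by norm_num)).1 h1
  omega

/-! ### The phases between two simulations -/

section Phases

variable {M : OracleTM} {base : List (Bool × Bool)}
  {S : Fin (M.extraTapes + 2) → Tape (Cell M.Symb)} {R : Tape (Option (Bool × Bool))}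
  {H : Tape (Option (Option (LogEntry M)))}

theorem reaches_incr_fixed {l : List (Bool × Bool)} (hl : ∀ a ∈ l, a.1 = false)
    (u v : List (Bool × Bool)) :
    (searcher M base).Reaches l.length ⟨.incr, S, seg u (l ++ v), H⟩
      ⟨.incr, S, seg (l.reverse ++ u) v, H⟩ := by
  induction l generalizing u with
  | nil => exact .refl _
  | cons a l ih =>
    obtain ⟨m, b⟩ := a
    obtain rfl : m = false := hl (m, b) List.mem_cons_self
    have h1 : (searcher M base).Reaches 1 ⟨.incr, S, seg u ((false, b) :: (l ++ v)), H⟩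
        ⟨.incr, S, seg ((false, b) :: u) (l ++ v), H⟩ :=
      .of_next rfl (seg_head_cons _ _ _) rfl rfl (actOn_keepTapes _) (actOn_seg_right _ _ _ _)
        (actOn_head_none H)
    have h2 := (h1.trans (ih (fun c hc => hl c (List.mem_cons_of_mem _ hc)) _)).mono
      (n := ((false, b) :: l).length) (by simp; omega)
    simpa using h2

/-- Either the carry stops at a marked 0, somewhere between u' and v', or it runs off the ruler. In
the latter case all marked bits have become 0 and one bit is still to be added. -/
theorem reaches_incr (n : ℕ) (ρ : List Bool) (u : List (Bool × Bool)) :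
    (∃ u' v', u'.reverse ++ v' = u.reverse ++ markCells n ((binSucc ρ).map (Prod.mk true)) ∧
      (binSucc ρ).length = ρ.length ∧
      (searcher M base).Reaches ((markCells n (ρ.map (Prod.mk true))).length + 1)
        ⟨.incr, S, seg u (markCells n (ρ.map (Prod.mk true))), H⟩ ⟨.rewind, S, segLeft u' v', H⟩) ∨
    (binSucc ρ = List.replicate (ρ.length + 1) false ∧
      (searcher M base).Reaches ((markCells n (ρ.map (Prod.mk true))).length + 1)
        ⟨.incr, S, seg u (markCells n (ρ.map (Prod.mk true))), H⟩
        ⟨.growRuler true, S,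
          seg ((markCells n ((List.replicate ρ.length false).map (Prod.mk true))).reverse ++ u) [],
          H⟩) := by
  induction ρ generalizing n u with
  | nil =>
    exact .inr ⟨rfl, .of_next rfl (seg_head_nil u) rfl rfl (actOn_keepTapes _)
      (actOn_seg_nil_none u) (actOn_head_none H)⟩
  | cons b ρ ih =>
    cases b with
    | false =>
      refine .inl ⟨u, markCells n ((true :: ρ).map (Prod.mk true)), rfl, rfl, ?_⟩
      refine MixedTM.Reaches.mono (m := 1) ?_ (by omega)
      exact .of_next rfl (seg_head_cons _ _ _) rfl rfl (actOn_keepTapes _)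
        (actOn_seg_left _ _ _ _) (actOn_head_none H)
    | true =>
      have h1 : (searcher M base).Reaches 1
          ⟨.incr, S, seg u (markCells n ((true :: ρ).map (Prod.mk true))), H⟩
          ⟨.incr, S, seg ((true, false) :: u) (List.replicate (2 ^ n - 1) (false, false) ++
            markCells (n + 1) (ρ.map (Prod.mk true))), H⟩ :=
        .of_next rfl (seg_head_cons _ _ _) rfl rfl (actOn_keepTapes _)
          (actOn_seg_right _ _ _ _) (actOn_head_none H)
      have h2 := h1.trans (reaches_incr_fixed (l := List.replicate (2 ^ n - 1) (false, false))
        (fun a ha => by rw [List.eq_of_mem_replicate ha]) _ _)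
      have hn : 1 + (List.replicate (2 ^ n - 1) (false, false)).length +
          ((markCells (n + 1) (ρ.map (Prod.mk true))).length + 1) ≤
            (markCells n ((true :: ρ).map (Prod.mk true))).length + 1 := by
        simp [markCells]; omega
      rcases ih (n + 1) ((List.replicate (2 ^ n - 1) (false, false)).reverse ++ (true, false) :: u)
        with ⟨u', v', e, hl, h⟩ | ⟨e, h⟩
      · refine .inl ⟨u', v', e.trans ?_, by simp [binSucc, hl], (h2.trans h).mono hn⟩
        simp [binSucc, markCells]
      · refine .inr ⟨by simp [binSucc, e, List.replicate_succ], ?_⟩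
        have h3 := (h2.trans h).mono hn
        simpa [List.replicate_succ, markCells] using h3

theorem reaches_rewind (u v : List (Bool × Bool)) :
    (searcher M base).Reaches (u.length + 1) ⟨.rewind, S, segLeft u v, H⟩
      ⟨.sim M.start, S, seg [] (u.reverse ++ v), H⟩ := by
  induction u generalizing v with
  | nil =>
    exact .of_next rfl (segLeft_nil_head v) rfl rfl (actOn_keepTapes _) (actOn_segLeft_nil v)
      (actOn_head_none H)
  | cons b u ih =>
    have h : (searcher M base).Reaches 1 ⟨.rewind, S, segLeft (b :: u) v, H⟩
        ⟨.rewind, S, segLeft u (b :: v), H⟩ := by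
      rw [segLeft_cons]
      exact .of_next rfl (seg_head_cons u v b) rfl rfl (actOn_keepTapes _)
        (actOn_seg_left u v b b) (actOn_head_none H)
    have h' := (h.trans (ih (b :: v))).mono (n := (b :: u).length + 1) (by simp; omega)
    simpa using h'

/-- With equally many cells to the left, both heads arrive together, so testing the ruler alone is
enough. -/
theorem reaches_home (u v : List (Bool × Bool)) (u' v' : List (Option (LogEntry M)))
    (hu : u.length = u'.length) :
    (searcher M base).Reaches (u.length + 1) ⟨.home, S, segLeft u v, segLeft u' v'⟩
      ⟨.sim M.start, S, seg [] (u.reverse ++ v), seg [] (u'.reverse ++ v')⟩ := by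
  induction u generalizing v u' v' with
  | nil =>
    obtain rfl := List.length_eq_zero_iff.1 hu.symm
    exact .of_next rfl (segLeft_nil_head v) (segLeft_nil_head v') rfl (actOn_keepTapes _)
      (actOn_segLeft_nil v) (actOn_segLeft_nil v')
  | cons b u ih =>
    obtain _ | ⟨b', u'⟩ := u'
    · simp at hu
    have h : (searcher M base).Reaches 1
        ⟨.home, S, segLeft (b :: u) v, segLeft (b' :: u') v'⟩
        ⟨.home, S, segLeft u (b :: v), segLeft u' (b' :: v')⟩ := by
      rw [segLeft_cons, segLeft_cons]
      exact .of_next rfl (seg_head_cons u v b) (seg_head_cons u' v' b') rfl (actOn_keepTapes _)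
        (actOn_seg_left u v b b) (actOn_seg_left u' v' b' b')
    have h' := (h.trans (ih (b :: v) u' (b' :: v') (by simpa using hu))).mono
      (n := (b :: u).length + 1) (by simp; omega)
    simpa using h'

theorem reaches_init (i : ℕ) (hi : i ≤ base.length) :
    (searcher M base).Reaches i ⟨.init 0, S, seg [] [], seg [] []⟩
      ⟨.init ⟨i, Nat.lt_succ_of_le hi⟩, S, seg (base.take i).reverse [],
        seg (List.replicate i none) []⟩ := by
  induction i with
  | zero => exact .refl _
  | succ i ih =>
    refine (ih (by omega)).trans ?_
    have h1 : searchNext M base (.init ⟨i, by omega⟩) (fun i => (S i).head) none none =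
        (.init ⟨i + 1, by omega⟩, keepTapes fun i => (S i).head, (some base[i], some .right),
          (some none, some .right)) := by
      have : i < base.length := hi
      simp [searchNext, this]
    rw [List.take_succ_eq_append_getElem hi, List.reverse_append]
    exact .of_next_eq rfl (seg_head_nil _) (seg_head_nil _) h1 (actOn_keepTapes _)
      (actOn_seg_append _ _) (actOn_seg_append _ _)

theorem reaches_start {n : ℕ} (hn : base.length = n) :
    (searcher M base).Reaches (2 * n + 2) ⟨.init 0, S, seg [] [], seg [] []⟩
      ⟨.sim M.start, S, seg [] base, seg [] (List.replicate n none)⟩ := by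
  subst hn
  have h1 := reaches_init (S := S) (M := M) base.length le_rfl
  rw [List.take_length] at h1
  have h2 : searchNext M base (.init ⟨base.length, Nat.lt_succ_of_le le_rfl⟩)
      (fun i => (S i).head) none none =
        (.home, keepTapes fun i => (S i).head, (none, some .left), (none, some .left)) := by
    simp [searchNext]
  have h3 : (searcher M base).Reaches 1
      ⟨.init ⟨base.length, Nat.lt_succ_of_le le_rfl⟩, S, seg base.reverse [],
        seg (List.replicate base.length none) []⟩
      ⟨.home, S, segLeft base.reverse [], segLeft (List.replicate base.length none) []⟩ :=
    .of_next_eq rfl (seg_head_nil _) (seg_head_nil _) h2 (actOn_keepTapes _)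
      (actOn_seg_nil_left _) (actOn_seg_nil_left _)
  have h4 := reaches_home (M := M) (base := base) (S := S) base.reverse []
    (List.replicate base.length none) [] (by simp)
  have h5 := ((h1.trans h3).trans h4).mono (n := 2 * base.length + 2) (by simp; omega)
  simpa using h5

/-- The log, as long as the old ruler, counts the cells to be appended. -/
theorem reaches_growRuler (w : List (Option (LogEntry M))) (u : List (Bool × Bool))
    (w' : List (Option (LogEntry M))) :
    (searcher M base).Reaches (w.length + 1) ⟨.growRuler false, S, seg u [], seg w' w⟩
      ⟨.growLog false, S, segLeft (List.replicate w.length (false, false) ++ u) [],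
        seg (w.reverse ++ w') []⟩ := by
  induction w generalizing u w' with
  | nil =>
    exact .of_next rfl (seg_head_nil _) (seg_head_nil _) rfl (actOn_keepTapes _)
      (actOn_seg_nil_left _) (actOn_seg_nil_none _)
  | cons e w ih =>
    have h : (searcher M base).Reaches 1 ⟨.growRuler false, S, seg u [], seg w' (e :: w)⟩
        ⟨.growRuler false, S, seg ((false, false) :: u) [], seg (e :: w') w⟩ :=
      .of_next rfl (seg_head_nil _) (seg_head_cons _ _ _) rfl (actOn_keepTapes _)
        (actOn_seg_append _ _) (actOn_seg_right _ _ _ _)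
    have h' := (h.trans (ih ((false, false) :: u) (e :: w'))).mono
      (n := (e :: w).length + 1) (by simp; omega)
    rw [List.length_cons, List.replicate_succ', List.append_assoc]
    simpa using h'

/-- The flag f is a parity: one log cell is added for every second cell of the doubled ruler, which
doubles the log as well. -/
theorem reaches_growLog (f : Bool) (u v : List (Bool × Bool)) (w : List (Option (LogEntry M))) :
    (searcher M base).Reaches (u.length + 1) ⟨.growLog f, S, segLeft u v, seg w []⟩
      ⟨.homeLog, S, seg [] (u.reverse ++ v),
        segLeft (List.replicate ((u.length + f.toNat) / 2) none ++ w) []⟩ := by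
  induction u generalizing f v w with
  | nil =>
    have : (([] : List (Bool × Bool)).length + f.toNat) / 2 = 0 := by cases f <;> rfl
    rw [this]
    exact .of_next rfl (segLeft_nil_head v) (seg_head_nil _) rfl (actOn_keepTapes _)
      (actOn_segLeft_nil v) (actOn_seg_nil_left _)
  | cons b u ih =>
    rw [segLeft_cons]
    cases f with
    | true =>
      have h : (searcher M base).Reaches 1 ⟨.growLog true, S, seg u (b :: v), seg w []⟩
          ⟨.growLog false, S, segLeft u (b :: v), seg (none :: w) []⟩ :=
        .of_next rfl (seg_head_cons _ _ _) (seg_head_nil _) rfl (actOn_keepTapes _)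
          (actOn_seg_left _ _ _ _) (actOn_seg_append _ _)
      have h' := (h.trans (ih false (b :: v) (none :: w))).mono
        (n := (b :: u).length + 1) (by simp; omega)
      have e : ((b :: u).length + true.toNat) / 2 = (u.length + false.toNat) / 2 + 1 := by
        simp; omega
      rw [e, List.replicate_succ', List.append_assoc]
      simpa using h'
    | false =>
      have h : (searcher M base).Reaches 1 ⟨.growLog false, S, seg u (b :: v), seg w []⟩
          ⟨.growLog true, S, segLeft u (b :: v), seg w []⟩ :=
        .of_next rfl (seg_head_cons _ _ _) (seg_head_nil _) rfl (actOn_keepTapes _)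
          (actOn_seg_left _ _ _ _) (actOn_seg_nil_none _)
      have h' := (h.trans (ih true (b :: v) w)).mono
        (n := (b :: u).length + 1) (by simp; omega)
      simpa using h'

theorem reaches_homeLog (u v : List (Option (LogEntry M))) :
    (searcher M base).Reaches (u.length + 1) ⟨.homeLog, S, R, segLeft u v⟩
      ⟨.sim M.start, S, R, seg [] (u.reverse ++ v)⟩ := by
  induction u generalizing v with
  | nil =>
    exact .of_next rfl rfl (segLeft_nil_head v) rfl (actOn_keepTapes _) (actOn_head_none R)
      (actOn_segLeft_nil v)
  | cons b u ih =>
    have h : (searcher M base).Reaches 1 ⟨.homeLog, S, R, segLeft (b :: u) v⟩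
        ⟨.homeLog, S, R, segLeft u (b :: v)⟩ := by
      rw [segLeft_cons]
      exact .of_next rfl rfl (seg_head_cons u v b) rfl (actOn_keepTapes _) (actOn_head_none R)
        (actOn_seg_left u v b b)
    have h' := (h.trans (ih (b :: v))).mono (n := (b :: u).length + 1) (by simp; omega)
    simpa using h'

theorem reaches_grow (u : List (Bool × Bool)) (hu : u ≠ []) :
    (searcher M base).Reaches (6 * u.length + 4)
      ⟨.growRuler true, S, seg u [], seg [] (List.replicate u.length none)⟩
      ⟨.sim M.start, S,
        seg [] (u.reverse ++ (true, false) :: List.replicate (u.length - 1) (false, false)),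
        seg [] (List.replicate (2 * u.length) none)⟩ := by
  obtain ⟨k, hk⟩ : ∃ k, u.length = k + 1 :=
    Nat.exists_eq_succ_of_ne_zero (mt List.length_eq_zero_iff.1 hu)
  rw [hk, List.replicate_succ]
  have h1 : (searcher M base).Reaches 1
      ⟨.growRuler true, S, seg u [], seg [] (none :: List.replicate k none)⟩
      ⟨.growRuler false, S, seg ((true, false) :: u) [], seg [none] (List.replicate k none)⟩ :=
    .of_next rfl (seg_head_nil _) (seg_head_cons _ _ _) rfl (actOn_keepTapes _)
      (actOn_seg_append _ _) (actOn_seg_right _ _ _ _)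
  have h2 := h1.trans (reaches_growRuler (List.replicate k none) ((true, false) :: u) [none])
  have h3 := h2.trans (reaches_growLog _ _ _ _)
  have h4 := h3.trans (reaches_homeLog _ _)
  have h5 := h4.mono (n := 6 * (k + 1) + 4) (by simp [hk]; omega)
  convert h5 using 2
  · simp
  · congr 1
    simp only [List.length_append, List.length_replicate, List.length_cons, hk, Bool.toNat_false,
      List.reverse_replicate, List.append_nil, ← List.replicate_one, List.replicate_append_replicate]
    congr 1
    omega

end Phases

end LowForSpeed

/-! ### Cost of the rounds and lowness for speed. -/

namespace LowForSpeed

open Turing (Tape ListBlank)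
open MixedTM (actOn)

/-! ### The running time of the search -/

theorem IsPrefixOf.exists_append {σ : List Bool} {G : Set ℕ} (h : IsPrefixOf σ G) (m : ℕ) :
    ∃ ρ : List Bool, ρ.length = m ∧ IsPrefixOf (σ ++ ρ) G := by
  classical
  refine ⟨(List.range m).map fun i => decide (σ.length + i ∈ G), by simp, fun i hi => ?_⟩
  by_cases hσ : i < σ.length
  · rw [List.getElem_append_left hσ]
    exact h i hσ
  · rw [List.getElem_append_right (by omega)]
    simp [show σ.length + (i - σ.length) = i by omega]

section Rounds

variable (M : OracleTM) (σ : List Bool) (x : List Bool)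

/-- The configuration before the simulation with the oracle given by `σ ++ ρ`. -/
def roundCfg (ρ : List Bool) : SCfg M (rulerOf σ []) where
  state := .sim M.start
  main := (M.init x).tape
  ruler := seg [] (rulerOf σ ρ)
  log := seg [] (List.replicate (2 ^ (σ.length + ρ.length)) none)

/-- The simulation with the oracle given by `σ ++ ρ` halts with output `b`. -/
def HaltsFor (ρ : List Bool) (b : Bool) : Prop :=
  ∃ t ≤ 2 ^ (σ.length + ρ.length),
    M.haltOutput ((M.step (sparseLang (bitSet (σ ++ ρ))))^[t] (M.init x)).state = some b

variable {M σ x}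

theorem reaches_roundCfg_nil :
    (searcher M (rulerOf σ [])).Reaches (2 * 2 ^ σ.length + 2)
      ((searcher M (rulerOf σ [])).init x) (roundCfg M σ x []) := by
  exact reaches_start (length_rulerOf σ [])

/-- The search stops at the first halting time of M, found by `Nat.find`, after at most T simulated
steps of cost 2T + 3. -/
theorem reaches_haltOutput {ρ : List Bool} (h : ∃ b, HaltsFor M σ x ρ b) :
    ∃ b, HaltsFor M σ x ρ b ∧ ∃ c, (searcher M (rulerOf σ [])).out c.state = some b ∧
      (searcher M (rulerOf σ [])).Reaches (30 * (2 ^ (σ.length + ρ.length)) ^ 2)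
        (roundCfg M σ x ρ) c := by
  classical
  set T := 2 ^ (σ.length + ρ.length) with hT
  set X := sparseLang (bitSet (σ ++ ρ)) with hX
  have hex : ∃ t, ∃ b, M.haltOutput ((M.step X)^[t] (M.init x)).state = some b := by
    obtain ⟨b, t, -, h⟩ := h
    exact ⟨t, b, h⟩
  obtain ⟨b, hb⟩ := Nat.find_spec hex
  have hmin : ∀ s < Nat.find hex, M.haltOutput ((M.step X)^[s] (M.init x)).state = none :=
    fun s hs => by
      by_contra hne
      exact Nat.find_min hex hs (Option.ne_none_iff_exists'.1 hne)
  have hle : Nat.find hex ≤ T := by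
    obtain ⟨b, t, ht, h⟩ := h
    exact (Nat.find_min' hex ⟨b, h⟩).trans ht
  generalize Nat.find hex = t at hb hmin hle
  rw [hX, ← rulerOracle_rulerOf] at hb hmin
  have h1 := reaches_sim (base := rulerOf σ []) (M.init x) (length_rulerOf σ ρ) t (T - t) hmin
  rw [← hT, Nat.add_sub_cancel' hle] at h1
  refine ⟨b, ⟨t, hle, by rwa [← rulerOracle_rulerOf]⟩, _, ?_, h1.mono ?_⟩
  · exact hb
  have hT1 : 1 ≤ T := Nat.one_le_two_pow
  calc t * (2 * T + 3) ≤ T * (2 * T + 3) := Nat.mul_le_mul_right _ hle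
    _ ≤ 30 * T ^ 2 := by nlinarith

/-- Simulation costs T (2T + 3); undoing, incrementing, and rewinding or growing are linear in T.
The constant 30 is generous. -/
theorem reaches_next_round {ρ : List Bool} (h : ¬ ∃ b, HaltsFor M σ x ρ b) :
    (searcher M (rulerOf σ [])).Reaches (30 * (2 ^ (σ.length + ρ.length)) ^ 2)
      (roundCfg M σ x ρ) (roundCfg M σ x (binSucc ρ)) := by
  set T := 2 ^ (σ.length + ρ.length) with hT
  have hno : ∀ t ≤ T, M.haltOutput
      ((M.step (rulerOracle (rulerOf σ ρ)))^[t] (M.init x)).state = none := by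
    intro t ht
    by_contra hne
    obtain ⟨b, hb⟩ := Option.ne_none_iff_exists'.1 hne
    rw [rulerOracle_rulerOf] at hb
    exact h ⟨b, t, ht, hb⟩
  have hT1 : 1 ≤ T := Nat.one_le_two_pow
  have hT2 : T * (2 * T + 3) = 2 * T ^ 2 + 3 * T := by ring
  have hT3 : T ≤ T ^ 2 := Nat.le_self_pow two_ne_zero T
  have hlen : (rulerOf σ []).length + (markCells σ.length (ρ.map (Prod.mk true))).length = T := by
    rw [← List.length_append, ← rulerOf_eq_append, length_rulerOf]
  have h1 := reaches_sim (base := rulerOf σ []) (M.init x) (length_rulerOf σ ρ) T 0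
    fun s hs => hno s hs.le
  rw [← hT] at h1
  have h2 : (searcher M (rulerOf σ [])).Reaches 1
      ⟨.sim ((M.step (rulerOracle (rulerOf σ ρ)))^[T] (M.init x)).state,
        ((M.step (rulerOracle (rulerOf σ ρ)))^[T] (M.init x)).tape, seg [] (rulerOf σ ρ),
        seg (logOf (rulerOracle (rulerOf σ ρ)) (M.init x) T) []⟩
      ⟨.back, ((M.step (rulerOracle (rulerOf σ ρ)))^[T] (M.init x)).tape, seg [] (rulerOf σ ρ),
        segLeft (logOf (rulerOracle (rulerOf σ ρ)) (M.init x) T) []⟩ :=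
    .of_next (hno T le_rfl) rfl (seg_head_nil _) rfl (actOn_keepTapes _) (actOn_head_none _)
      (actOn_seg_nil_left _)
  have h3 := (h1.trans h2).trans (reaches_back (rulerOracle (rulerOf σ ρ)) (M.init x) T [])
  rw [List.append_nil, rulerOf_eq_append σ ρ] at h3
  have h4 := h3.trans (reaches_incr_fixed (fun a => fst_eq_false_of_mem_rulerOf_nil) [] _)
  rw [← rulerOf_eq_append σ ρ] at h4
  rcases reaches_incr (M := M) (base := rulerOf σ []) (S := (M.init x).tape)
      (H := seg [] (List.replicate T none)) σ.length ρ ((rulerOf σ []).reverse ++ [])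
    with ⟨u', v', e, hl, h5⟩ | ⟨e, h5⟩
  · have h6 := (h4.trans h5).trans (reaches_rewind u' v')
    have hu' : u'.length ≤ T := by
      have := congrArg List.length e
      rw [List.append_nil, List.reverse_reverse, ← rulerOf_eq_append, length_rulerOf, hl,
        List.length_append, List.length_reverse] at this
      omega
    rw [e, List.append_nil, List.reverse_reverse, ← rulerOf_eq_append] at h6
    have h7 : roundCfg M σ x (binSucc ρ) = ⟨.sim M.start, (M.init x).tape,
        seg [] (rulerOf σ (binSucc ρ)), seg [] (List.replicate T none)⟩ := by
      rw [roundCfg, hl]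
    rw [h7]
    exact h6.mono (by omega)
  · set u := (markCells σ.length ((List.replicate ρ.length false).map (Prod.mk true))).reverse ++
      ((rulerOf σ []).reverse ++ []) with hu
    have hur : u.reverse = rulerOf σ (List.replicate ρ.length false) := by
      rw [hu, rulerOf_eq_append σ (List.replicate _ _)]
      simp
    have hul : u.length = T := by
      rw [← List.length_reverse, hur, length_rulerOf, List.length_replicate]
    have hune : u ≠ [] := by
      rintro h0
      rw [h0] at hul
      simp at hul
      omega
    have h6 := reaches_grow (M := M) (base := rulerOf σ []) (S := (M.init x).tape) u hune
    rw [hul, hur] at h6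
    have h7 : roundCfg M σ x (binSucc ρ) = ⟨.sim M.start, (M.init x).tape,
        seg [] (rulerOf σ (List.replicate ρ.length false) ++
          (true, false) :: List.replicate (T - 1) (false, false)),
        seg [] (List.replicate (2 * T) none)⟩ := by
      -- The added bit occupies a marked cell at position T, followed by its gap of T - 1 cells.
      have h8 : rulerOf σ (binSucc ρ) = rulerOf σ (List.replicate ρ.length false) ++
          (true, false) :: List.replicate (T - 1) (false, false) := by
        rw [e, List.replicate_succ', rulerOf_eq_append, rulerOf_eq_append σ (List.replicate _ _),
          List.map_append, markCells_append]
        simp [markCells, hT]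
      rw [roundCfg, h8, e, List.length_replicate, ← add_assoc, pow_succ, mul_comm _ 2]
    rw [h7]
    exact ((h4.trans h5).trans h6).mono (by omega)

/-- Induction on the number d of rounds from ρ to ρ'. An earlier round ρ₁ may already give an
output, so nothing is claimed about ρ₁ beyond halting. -/
theorem exists_reaches_output {ρ' : List Bool} (h : ∃ b, HaltsFor M σ x ρ' b) (d : ℕ)
    (ρ : List Bool) (hd : binIndex ρ + d = binIndex ρ') :
    ∃ ρ₁ b, HaltsFor M σ x ρ₁ b ∧ ∃ c, (searcher M (rulerOf σ [])).out c.state = some b ∧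
      (searcher M (rulerOf σ [])).Reaches
        ((d + 1) * (30 * (2 ^ (σ.length + ρ'.length)) ^ 2)) (roundCfg M σ x ρ) c := by
  have hle : 30 * (2 ^ (σ.length + ρ.length)) ^ 2 ≤ 30 * (2 ^ (σ.length + ρ'.length)) ^ 2 := by
    have := length_le_of_binIndex_le (ρ := ρ) (ρ' := ρ') (by omega)
    gcongr
    norm_num
  induction d generalizing ρ with
  | zero =>
    obtain rfl : ρ = ρ' := binIndex_injective hd
    obtain ⟨b, hb, c, hc, hr⟩ := reaches_haltOutput h
    exact ⟨ρ, b, hb, c, hc, hr.mono (by omega)⟩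
  | succ d ih =>
    by_cases hρ : ∃ b, HaltsFor M σ x ρ b
    · obtain ⟨b, hb, c, hc, hr⟩ := reaches_haltOutput hρ
      exact ⟨ρ, b, hb, c, hc, hr.mono (hle.trans (Nat.le_mul_of_pos_left _ (by omega)))⟩
    · have h1 := reaches_next_round hρ
      have hd' : binIndex (binSucc ρ) + d = binIndex ρ' := by
        rw [binIndex_binSucc]; omega
      have hle' := length_le_of_binIndex_le (ρ := binSucc ρ) (ρ' := ρ') (by omega)
      obtain ⟨ρ₁, b, hb, c, hc, hr⟩ := ih (binSucc ρ) hd' (by gcongr; norm_num)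
      refine ⟨ρ₁, b, hb, c, hc, (h1.trans hr).mono ?_⟩
      rw [Nat.succ_mul (d + 1), add_comm]
      exact Nat.add_le_add_left hle _

end Rounds

theorem two_pow_size_le (n : ℕ) : 2 ^ n.size ≤ 2 * n + 1 := by
  rcases h : n.size with _ | k
  · simp
  · have := Nat.lt_size.1 (show k < n.size by omega)
    rw [pow_succ]
    omega

theorem IsOneGeneric.isLowForSpeed {G : Set ℕ} (hG : IsOneGeneric G) :
    IsLowForSpeed (sparseLang G) := by
  intro L hL M f hM
  obtain ⟨σ, hσ, hforce⟩ := hG.exists_forcing hL hM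
  have := M.finiteState
  have := M.finiteSymb
  have := SearchState.finite M.State (rulerOf σ []).length
  -- The cube bounds at most 2T rounds of cost 30 T ^ 2 plus the initialization, where T ≤ 2 ^ |σ| *
  -- (4 * f x + 1).
  refine ⟨(searcher M (rulerOf σ [])).toOracleTM,
    64 * (Polynomial.C (2 ^ σ.length) * (4 * Polynomial.X + 1)) ^ 3,
    MixedTM.toOracleTM_oracleFree _, fun x => ?_⟩
  -- With this length T ≥ 2 * f x: the time budget suffices, and σ ++ ρ answers correctly all
  -- queries that M makes within f x steps.
  obtain ⟨ρ, hρ, hpre⟩ := hσ.exists_append (2 * f x).size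
  set T := 2 ^ (σ.length + ρ.length) with hT
  have hfT : 2 * f x ≤ T := by
    have h1 : 2 * f x < 2 ^ ρ.length := hρ ▸ Nat.lt_size_self _
    have h2 : 2 ^ ρ.length ≤ T := Nat.pow_le_pow_right two_pos (by omega)
    omega
  have hTf : T ≤ 2 ^ σ.length * (4 * f x + 1) := by
    rw [hT, pow_add, hρ]
    refine Nat.mul_le_mul_left _ ((two_pow_size_le _).trans ?_)
    omega
  have hhalt : ∃ b, HaltsFor M σ x ρ b := by
    obtain ⟨b, ⟨n, hn, hb⟩, -⟩ := hM x
    refine ⟨b, n, by omega, ?_⟩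
    rw [M.haltOutput_eq_some, M.iterate_step_congr x (Y := sparseLang G)
      fun w hw => mem_sparseLang_congr hpre (by rw [List.length_append]; omega)]
    exact hb
  have hidx : binIndex [] + (binIndex ρ - 1) = binIndex ρ := by
    have := one_le_binIndex ρ
    rw [binIndex]
    omega
  obtain ⟨ρ₁, b, ⟨t, -, hb⟩, c, hc, hr⟩ := exists_reaches_output hhalt _ [] hidx
  obtain ⟨m, hm, rfl⟩ := reaches_roundCfg_nil.trans hr
  -- The output may come from a string σ ++ ρ₁ that is no prefix of G; `hforce` makes it correct
  -- because it extends σ.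
  refine ⟨b, MixedTM.haltsWithin_of_iterate _ (hm.trans ?_) hc,
    hforce _ x t b (List.prefix_append σ ρ₁) (M.haltOutput_eq_some.1 hb)⟩
  have hσT : 2 ^ σ.length ≤ T := Nat.pow_le_pow_right two_pos (by omega)
  have hT1 : 1 ≤ T := Nat.one_le_two_pow
  have hρT : binIndex ρ - 1 + 1 ≤ 2 * T := by
    have h1 := binIndex_lt ρ
    have h2 : 2 ^ ρ.length ≤ T := Nat.pow_le_pow_right two_pos (by omega)
    rw [pow_succ] at h1
    omega
  calc 2 * 2 ^ σ.length + 2 + (binIndex ρ - 1 + 1) * (30 * T ^ 2)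
      ≤ 2 * T + 2 + 2 * T * (30 * T ^ 2) := by gcongr
    _ ≤ 64 * T ^ 3 := by nlinarith [Nat.pow_le_pow_right hT1 (show 1 ≤ 3 by norm_num)]
    _ ≤ 64 * (2 ^ σ.length * (4 * f x + 1)) ^ 3 := by gcongr
    _ = _ := by simp

end LowForSpeed

theorem mainTheorem10 :
    ∃ (G : Set ℕ) (X : Language Bool),
      LowForSpeed.IsOneGeneric G ∧
      TuringReducible (LowForSpeed.charFn G) (LowForSpeed.charFn (LowForSpeed.jump ∅)) ∧
      X = LowForSpeed.sparseLang G ∧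
      LowForSpeed.IsLow X ∧
      ¬ LowForSpeed.IsComputable X ∧
      LowForSpeed.IsLowForSpeed X :=
  ⟨LowForSpeed.genericSet, _, LowForSpeed.isOneGeneric_genericSet,
    LowForSpeed.genericSet_le_jump, rfl, LowForSpeed.isLow_sparseLang_genericSet,
    LowForSpeed.not_isComputable_sparseLang LowForSpeed.isOneGeneric_genericSet,
    LowForSpeed.isOneGeneric_genericSet.isLowForSpeed⟩
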